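/- Fix the following optimization problem (WS-Exp$^H$). Let $\mathcal X\subseteq\{0,1\}^n$ be a set of feasible solutions. The data are a rational weight $\alpha\in(0,1)$, rational item costs $c_1,\dots,c_n$, a set $E'\subseteq[n]$ of important items, a number $N\ge 1$ of historic data points, feasible historic solutions $\boldsymbol x^1,\dots,\boldsymbol x^N\in\mathcal X$, and rational weights $\tilde\lambda_1,\dots,\tilde\lambda_N$ (of arbitrary sign). For $\boldsymbol x\in\{0,1\}^n$ let $\chi_{E'}(\boldsymbol x)=(x_j)_{j\in E'}\in\{0,1\}^{E'}$ and let $H$ denote the Hamming distance. The task is to find an optimal solution $\boldsymbol x\in\mathcal X$ of $$\min_{\boldsymbol x\in\mathcal X}\ \alpha\sum_{j=1}^n c_jx_j+(1-\alpha)\sum_{i=1}^N\tilde\lambda_i\,H\bigl(\chi_{E'}(\boldsymbol x),\chi_{E'}(\boldsymbol x^i)\bigr).$$ This problem can be solved in polynomial time in each of the following two cases: 1. (Shortest paths in directed acyclic graphs.) The input contains a finite directed acyclic graph $G=(V,E)$ with $E\subseteq V\times V$, $|E|=n$, and two vertices $s,t\in V$; the items are the edges, and $\mathcal X$ is the set of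 incidence vectors of the edge sets of directed $s$-$t$ paths. 2. (Minimum spanning trees.) The input contains a finite simple undirected graph $G=(V,E)$ with $|E|=n$; the items are the edges, and $\mathcal X$ is the set of incidence vectors of the edge sets of spanning trees of $G$. Here "solved in polynomial time" means that in each case there is one program for a random access machine with logarithmic cost which, for every instance as above, halts and outputs an optimal $\boldsymbol x$ after a running time bounded by a fixed polynomial in the input size. The input consists of the vertex list and the edge list of $G$, of $s$ and $t$ in the first case, and of $\alpha$, $(c_j)_j$, $N$, $(\tilde\lambda_i)_i$, $E'$ and $(\boldsymbol x^i)_i$, where the numerators and denominators of rational numbers are written in binary. -/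

import Mathlib

namespace ExplOpt

/-! ### Random access machines with logarithmic cost

A program works on finitely many integer arrays (named by natural numbers, with cells addressed by
integers, initially zero apart from the input). An operation on integers is charged the bit length
of the integers (addresses included) that take part in it, plus one. -/

/-- Binary length of an integer. -/
def bits (z : ℤ) : ℕ := z.natAbs.size

/-- The memory: the content of each cell of each array. -/
abbrev Store : Type := ℕ → ℤ → ℤ

/-- Integer expressions; `cell k a` is the content of the cell of array `k` with address `a`. -/
inductive Expr : Type
  | const (z : ℤ)
  | cell (k : ℕ) (a : Expr)
  | add (e f : Expr)
  | sub (e f : Expr)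
  | mul (e f : Expr)
  | div (e f : Expr)

/-- Value of an expression (`div` is integer division, with value `0` if the divisor is `0`). -/
def Expr.val (σ : Store) : Expr → ℤ
  | const z => z
  | cell k a => σ k (a.val σ)
  | add e f => e.val σ + f.val σ
  | sub e f => e.val σ - f.val σ
  | mul e f => e.val σ * f.val σ
  | div e f => e.val σ / f.val σ

/-- Logarithmic cost of evaluating an expression: the cost of the operands, which accounts for
their bit lengths, plus one, plus the bit length of the result. -/
def Expr.cost (σ : Store) : Expr → ℕ
  | const z => 1 + bits z
  | cell k a => a.cost σ + 1 + bits (σ k (a.val σ))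
  | add e f => e.cost σ + f.cost σ + 1 + bits (e.val σ + f.val σ)
  | sub e f => e.cost σ + f.cost σ + 1 + bits (e.val σ - f.val σ)
  | mul e f => e.cost σ + f.cost σ + 1 + bits (e.val σ * f.val σ)
  | div e f => e.cost σ + f.cost σ + 1 + bits (e.val σ / f.val σ)

/-- Programs: do nothing, write the value of `e` into cell `a` of array `k`, composition,
branching on `0 < e`, and looping while `0 < e`. -/
inductive Prog : Type
  | nop
  | assign (k : ℕ) (a e : Expr)
  | seq (P Q : Prog)
  | branch (e : Expr) (P Q : Prog)
  | loop (e : Expr) (P : Prog)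

/-- Write `z` into the cell of array `k` with address `a`. -/
def Store.write (σ : Store) (k : ℕ) (a z : ℤ) : Store :=
  Function.update σ k (Function.update (σ k) a z)

/-- `Exec P σ τ t`: started with memory `σ`, the program `P` halts with memory `τ`
after a running time of exactly `t`. -/
inductive Exec : Prog → Store → Store → ℕ → Prop
  | nop (σ : Store) : Exec Prog.nop σ σ 1
  | assign (k : ℕ) (a e : Expr) (σ : Store) :
      Exec (Prog.assign k a e) σ (σ.write k (a.val σ) (e.val σ)) (a.cost σ + e.cost σ + 1)
  | seq {P Q : Prog} {σ τ υ : Store} {t u : ℕ} :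
      Exec P σ τ t → Exec Q τ υ u → Exec (Prog.seq P Q) σ υ (t + u)
  | branch_pos {e : Expr} {P Q : Prog} {σ τ : Store} {t : ℕ} :
      0 < e.val σ → Exec P σ τ t → Exec (Prog.branch e P Q) σ τ (e.cost σ + 1 + t)
  | branch_nonpos {e : Expr} {P Q : Prog} {σ τ : Store} {t : ℕ} :
      e.val σ ≤ 0 → Exec Q σ τ t → Exec (Prog.branch e P Q) σ τ (e.cost σ + 1 + t)
  | loop_done {e : Expr} {P : Prog} {σ : Store} :
      e.val σ ≤ 0 → Exec (Prog.loop e P) σ σ (e.cost σ + 1)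
  | loop_step {e : Expr} {P : Prog} {σ τ υ : Store} {t u : ℕ} :
      0 < e.val σ → Exec P σ τ t → Exec (Prog.loop e P) τ υ u →
      Exec (Prog.loop e P) σ υ (e.cost σ + 1 + t + u)

/-- A word of integers written into an array: its length in cell `0`, its letters in the cells
`1, 2, …`, and `0` elsewhere. -/
def wordArray (w : List ℤ) (a : ℤ) : ℤ :=
  if a = 0 then (w.length : ℤ) else if 0 < a then w.getD (a.toNat - 1) 0 else 0

/-- The initial memory: the input word in array `0`, all other arrays zero. -/
def initStore (w : List ℤ) : Store := fun k => if k = 0 then wordArray w else fun _ => 0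

/-- The output of a halted program is the word `y`, stored in array `1`: the length in
cell `0`, the letters in the cells `1, 2, …`. -/
def Outputs (σ : Store) (y : List ℤ) : Prop :=
  σ 1 0 = (y.length : ℤ) ∧ ∀ i : Fin y.length, σ 1 ((i : ℕ) + 1 : ℤ) = y.get i

/-- Size of an input word: the total length of its letters in binary, plus one per letter. -/
def wordSize (w : List ℤ) : ℕ := (w.map fun z => bits z + 1).sum

/-- A search problem, with instances `I : ι` presented as the words `enc I` and with correct
answers the words `y` such that `Correct I y`, is solvable in polynomial time: one program
outputs a correct answer for every instance, in time polynomial in the input size. -/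
def PolyTimeSolvable {ι : Type} (enc : ι → List ℤ) (Correct : ι → List ℤ → Prop) : Prop :=
  ∃ (P : Prog) (p : Polynomial ℕ), ∀ I : ι, ∃ (τ : Store) (t : ℕ) (y : List ℤ),
    Exec P (initStore (enc I)) τ t ∧ t ≤ p.eval (wordSize (enc I)) ∧
      Outputs τ y ∧ Correct I y

/-! ### The weighted sum problem with Hamming distance -/

/-- Numerical data of the explainable problem with `n` items, apart from the feasible set. -/
structure WSData (n : ℕ) where
  /-- scalarization weight -/
  α : ℚ
  /-- item costs of the current instance -/
  c : Fin n → ℚ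
  /-- number of historic data points -/
  N : ℕ
  /-- weights of the historic data points (confidence scaled by instance similarity) -/
  lam : Fin N → ℚ
  /-- historic solutions -/
  hist : Fin N → Fin n → Bool
  /-- the set `E'` of important items -/
  imp : Finset (Fin n)

/-- The feature map: the restriction of a binary vector to the important items. -/
def chi {n : ℕ} (E' : Finset (Fin n)) (x : Fin n → Bool) : {j : Fin n // j ∈ E'} → Bool :=
  fun j => x j.1

/-- The objective function: `α ∑ⱼ cⱼ xⱼ + (1 - α) ∑ᵢ λᵢ H(χ(x), χ(xⁱ))`. -/
def WSData.objective {n : ℕ} (D : WSData n) (x : Fin n → Bool) : ℚ :=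
  D.α * ∑ j, D.c j * ((x j).toNat : ℚ) +
    (1 - D.α) * ∑ i, D.lam i * (hammingDist (chi D.imp x) (chi D.imp (D.hist i)) : ℚ)

/-- The data fit the feasible set `X`: the weight lies in `(0, 1)`, and there is at least one
historic solution, all of them feasible. -/
structure WSData.Admissible {n : ℕ} (D : WSData n) (X : Set (Fin n → Bool)) : Prop where
  α_pos : 0 < D.α
  α_lt_one : D.α < 1
  N_pos : 0 < D.N
  hist_mem : ∀ i, D.hist i ∈ X

/-- `x` is an optimal solution of the problem over the feasible set `X`. -/
def WSData.IsOptimal {n : ℕ} (D : WSData n) (X : Set (Fin n → Bool)) (x : Fin n → Bool) : Prop :=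
  x ∈ X ∧ IsMinOn D.objective X x

/-- A binary vector as a word. -/
def encVec {n : ℕ} (x : Fin n → Bool) : List ℤ := List.ofFn fun j => ((x j).toNat : ℤ)

/-- A vector of rationals as a word: the numerators, then the (positive) denominators. -/
def encRats {n : ℕ} (q : Fin n → ℚ) : List ℤ :=
  (List.ofFn fun j => (q j).num) ++ List.ofFn fun j => ((q j).den : ℤ)

/-- The numerical data as a word. -/
def WSData.encode {n : ℕ} (D : WSData n) : List ℤ :=
  [(D.N : ℤ), D.α.num, (D.α.den : ℤ)] ++ encRats D.c ++ encRats D.lam ++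
    encVec (fun j => decide (j ∈ D.imp)) ++ (List.ofFn fun i => encVec (D.hist i)).flatten

/-- A graph given by its vertices `0, …, m - 1` and its edges `0, …, n - 1`, each with two ends,
as a word: the numbers of vertices and edges, the list of vertices, and the lists of first and of
second ends. -/
def encGraph {m n : ℕ} (tail head : Fin n → Fin m) : List ℤ :=
  [(m : ℤ), (n : ℤ)] ++ (List.ofFn fun v : Fin m => ((v : ℕ) : ℤ)) ++
    (List.ofFn fun j => ((tail j : ℕ) : ℤ)) ++ List.ofFn fun j => ((head j : ℕ) : ℤ)

/-! ### Shortest paths in directed acyclic graphs -/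

/-- `p` lists the edges of a directed walk from `u` to `v`. -/
def IsDiwalk {m n : ℕ} (tail head : Fin n → Fin m) : Fin m → List (Fin n) → Fin m → Prop
  | u, [], v => u = v
  | u, j :: p, v => tail j = u ∧ IsDiwalk tail head (head j) p v

/-- `p` lists the edges of a directed path from `s` to `t`: a walk without repeated vertices. -/
def IsDipath {m n : ℕ} (tail head : Fin n → Fin m) (s : Fin m) (p : List (Fin n)) (t : Fin m) :
    Prop :=
  IsDiwalk tail head s p t ∧ (s :: p.map head).Nodup

/-- The directed graph has no directed cycle (loops included). -/
def IsAcyclicDigraph {m n : ℕ} (tail head : Fin n → Fin m) : Prop :=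
  ∀ v, ¬ Relation.TransGen (fun a b => ∃ j, tail j = a ∧ head j = b) v v

/-- The incidence vectors of the edge sets of directed paths from `s` to `t`. -/
def dipathVectors {m n : ℕ} (tail head : Fin n → Fin m) (s t : Fin m) : Set (Fin n → Bool) :=
  {x | ∃ p : List (Fin n), IsDipath tail head s p t ∧ ∀ j, x j = true ↔ j ∈ p}

/-- An instance of the explainable shortest path problem in a directed acyclic graph. -/
structure DagInstance : Type where
  m : ℕ
  n : ℕ
  tail : Fin n → Fin m
  head : Fin n → Fin m
  edges_distinct : Function.Injective fun j => (tail j, head j)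
  acyclic : IsAcyclicDigraph tail head
  s : Fin m
  t : Fin m
  data : WSData n
  admissible : data.Admissible (dipathVectors tail head s t)

/-- The instance as a word. -/
def DagInstance.encode (I : DagInstance) : List ℤ :=
  encGraph I.tail I.head ++ [((I.s : ℕ) : ℤ), ((I.t : ℕ) : ℤ)] ++ I.data.encode

/-- The answer `y` is (the word of) an optimal solution. -/
def DagInstance.Correct (I : DagInstance) (y : List ℤ) : Prop :=
  ∃ x, I.data.IsOptimal (dipathVectors I.tail I.head I.s I.t) x ∧ y = encVec x

/-! ### Minimum spanning trees -/

/-- The graph on all vertices with the edges selected by `x`. -/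
def selectedGraph {m n : ℕ} (tail head : Fin n → Fin m) (x : Fin n → Bool) :
    SimpleGraph (Fin m) :=
  SimpleGraph.fromEdgeSet {e | ∃ j, x j = true ∧ e = s(tail j, head j)}

/-- The incidence vectors of spanning trees. -/
def spanningTreeVectors {m n : ℕ} (tail head : Fin n → Fin m) : Set (Fin n → Bool) :=
  {x | (selectedGraph tail head x).IsTree}

/-- An instance of the explainable minimum spanning tree problem, in a finite simple undirected
graph; the order of the two ends of an edge is immaterial. -/
structure MstInstance : Type where
  m : ℕ
  n : ℕ
  tail : Fin n → Fin m
  head : Fin n → Fin m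
  loopless : ∀ j, tail j ≠ head j
  edges_distinct : Function.Injective fun j => s(tail j, head j)
  data : WSData n
  admissible : data.Admissible (spanningTreeVectors tail head)

/-- The instance as a word. -/
def MstInstance.encode (I : MstInstance) : List ℤ :=
  encGraph I.tail I.head ++ I.data.encode

/-- The answer `y` is (the word of) an optimal solution. -/
def MstInstance.Correct (I : MstInstance) (y : List ℤ) : Prop :=
  ∃ x, I.data.IsOptimal (spanningTreeVectors I.tail I.head) x ∧ y = encVec x

end ExplOpt

namespace ExplOpt

/-! ### Bit lengths -/

/-! On bits, the indicator of `a ≠ b` is `b + (1 - 2b) a`, which is affine in `a`. For fixed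
historic solutions the Hamming term is therefore affine in `x` (`hammingDist_chi`), and up to a
positive factor and an additive constant the objective is a linear function with item weights of
arbitrary sign (`WSData.exists_objective_eq`). Two classical problems with signed weights remain.

In an acyclic digraph every walk is a path, so Bellman–Ford relaxation of walks to `t` is exact even
for negative weights (`LabelsGood`, `LabelsSound`). For spanning trees Prim's algorithm works for
any real weights: by the cut property (`IsPartialTree.insert_edge`, based on
`exists_isTree_exchange`), a lightest edge leaving the current vertex set can be added without
losing extendability to a minimum spanning tree. Admissibility supplies a historic solution, so the
feasible set is never empty.

The logarithmic cost requires short integers. Denominators are cleared with the product `Q` of all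
positive input letters, a common multiple of at most `2 ^ S` for input size `S`
(`letterProduct_le`). The weights are then at most `2 ^ (4 * S)` in absolute value, and walk weights
gain only the factor `m + 1`. Hence all cells keep at most `10 * S + 10` bits. The running time is
bounded syntactically by `Prog.timeBound`, a semiring expression in this one parameter and thus a
polynomial in `S`; the predicate `WP` carries this bound together with correctness. -/

theorem bits_le_iff {z : ℤ} {b : ℕ} : bits z ≤ b ↔ |z| < 2 ^ b := by
  rw [bits, Nat.size_le, Int.abs_eq_natAbs]
  exact_mod_cast Iff.rfl

theorem bits_natCast_le {k M : ℕ} (h : k ≤ M) : bits (k : ℤ) ≤ M := by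
  rw [bits, Int.natAbs_natCast, Nat.size_le]
  exact Nat.lt_two_pow_self.trans_le (Nat.pow_le_pow_right two_pos h)

/-- The bound is `a + b + 1` rather than a maximum plus one because width bounds have to be
expressions in a commutative semiring, polynomials included. -/
theorem bits_add_le {x y : ℤ} {a b : ℕ} (hx : bits x ≤ a) (hy : bits y ≤ b) :
    bits (x + y) ≤ a + b + 1 := by
  rw [bits_le_iff] at *
  have h1 : (2 : ℤ) ^ a ≤ 2 ^ (a + b) := pow_le_pow_right₀ (by norm_num) (by omega)
  have h2 : (2 : ℤ) ^ b ≤ 2 ^ (a + b) := pow_le_pow_right₀ (by norm_num) (by omega)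
  have := abs_add_le x y
  rw [pow_succ]
  linarith

theorem bits_neg (x : ℤ) : bits (-x) = bits x := by simp [bits]

theorem bits_sub_le {x y : ℤ} {a b : ℕ} (hx : bits x ≤ a) (hy : bits y ≤ b) :
    bits (x - y) ≤ a + b + 1 := by
  rw [sub_eq_add_neg]
  exact bits_add_le hx (by rwa [bits_neg])

theorem bits_mul_le {x y : ℤ} {a b : ℕ} (hx : bits x ≤ a) (hy : bits y ≤ b) :
    bits (x * y) ≤ a + b := by
  rw [bits_le_iff] at *
  rw [abs_mul, pow_add]
  exact mul_lt_mul'' hx hy (abs_nonneg _) (abs_nonneg _)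

theorem bits_div_le {x : ℤ} (y : ℤ) {a : ℕ} (hx : bits x ≤ a) : bits (x / y) ≤ a :=
  (Nat.size_le_size (Int.natAbs_ediv_le_natAbs x y)).trans hx

/-! ### Syntactic bounds on the running time -/

/-- Bound on the bit length of the value of an expression if all cells have at most `M` bits. -/
def Expr.width {R : Type} [CommSemiring R] (M : R) : Expr → R
  | const z => (bits z : R)
  | cell _ _ => M
  | add e f => e.width M + f.width M + 1
  | sub e f => e.width M + f.width M + 1
  | mul e f => e.width M + f.width M
  | div e _ => e.width M

/-- Bound on the cost of an expression if all cells have at most `M` bits. -/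
def Expr.costBound {R : Type} [CommSemiring R] (M : R) : Expr → R
  | const z => 1 + (bits z : R)
  | cell _ a => a.costBound M + 1 + M
  | add e f => e.costBound M + f.costBound M + 1 + (add e f).width M
  | sub e f => e.costBound M + f.costBound M + 1 + (sub e f).width M
  | mul e f => e.costBound M + f.costBound M + 1 + (mul e f).width M
  | div e f => e.costBound M + f.costBound M + 1 + (div e f).width M

/-- Bound on the running time if all cells have at most `M` bits at any time and every loop is
repeated at most `M` times whenever it is entered. -/
def Prog.timeBound {R : Type} [CommSemiring R] (M : R) : Prog → R
  | nop => 1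
  | assign _ a e => a.costBound M + e.costBound M + 1
  | seq P Q => P.timeBound M + Q.timeBound M
  | branch e P Q => e.costBound M + 1 + (P.timeBound M + Q.timeBound M)
  | loop e P => (M + 1) * (e.costBound M + 1 + P.timeBound M)

/-- The bounds commute with semiring homomorphisms. Read in `ℕ[X]` they are polynomials, and
evaluation returns the numerical bounds. -/
theorem Expr.map_width {R S : Type} [CommSemiring R] [CommSemiring S] (φ : R →+* S) (M : R)
    (e : Expr) : φ (e.width M) = e.width (φ M) := by
  induction e <;> simp_all [Expr.width]

theorem Expr.map_costBound {R S : Type} [CommSemiring R] [CommSemiring S] (φ : R →+* S) (M : R)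
    (e : Expr) : φ (e.costBound M) = e.costBound (φ M) := by
  induction e <;> simp_all [Expr.costBound, Expr.map_width]

theorem Prog.map_timeBound {R S : Type} [CommSemiring R] [CommSemiring S] (φ : R →+* S) (M : R)
    (P : Prog) : φ (P.timeBound M) = P.timeBound (φ M) := by
  induction P <;> simp_all [Prog.timeBound, Expr.map_costBound]

/-- All cells of the memory have at most `M` bits. -/
def Bounded (M : ℕ) (σ : Store) : Prop := ∀ k a, bits (σ k a) ≤ M

theorem Expr.bits_val_le {M : ℕ} {σ : Store} (h : Bounded M σ) (e : Expr) :
    bits (e.val σ) ≤ e.width M := by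
  induction e with
  | const z => simp [Expr.val, Expr.width]
  | cell k a => exact h _ _
  | add e f he hf => exact bits_add_le he hf
  | sub e f he hf => exact bits_sub_le he hf
  | mul e f he hf => exact bits_mul_le he hf
  | div e f he hf => exact bits_div_le _ he

theorem Expr.cost_le {M : ℕ} {σ : Store} (h : Bounded M σ) (e : Expr) :
    e.cost σ ≤ e.costBound M := by
  induction e with
  | const z => simp [Expr.cost, Expr.costBound]
  | cell k a ih => exact Nat.add_le_add (Nat.add_le_add_right ih 1) (h _ _)
  | add e f he hf =>
    exact Nat.add_le_add (Nat.add_le_add_right (Nat.add_le_add he hf) 1)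
      ((Expr.add e f).bits_val_le h)
  | sub e f he hf =>
    exact Nat.add_le_add (Nat.add_le_add_right (Nat.add_le_add he hf) 1)
      ((Expr.sub e f).bits_val_le h)
  | mul e f he hf =>
    exact Nat.add_le_add (Nat.add_le_add_right (Nat.add_le_add he hf) 1)
      ((Expr.mul e f).bits_val_le h)
  | div e f he hf =>
    exact Nat.add_le_add (Nat.add_le_add_right (Nat.add_le_add he hf) 1)
      ((Expr.div e f).bits_val_le h)

/-! ### Verification of programs -/

theorem Store.write_same (σ : Store) (k : ℕ) (a z : ℤ) :
    σ.write k a z k = Function.update (σ k) a z := by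
  simp [Store.write]

theorem Store.write_ne (σ : Store) {k l : ℕ} (h : l ≠ k) (a z : ℤ) : σ.write k a z l = σ l := by
  simp [Store.write, h]

theorem Bounded.write {M : ℕ} {σ : Store} (h : Bounded M σ) (k : ℕ) (a : ℤ) {z : ℤ}
    (hz : bits z ≤ M) : Bounded M (σ.write k a z) := by
  intro l b
  by_cases hl : l = k
  · subst hl
    rw [Store.write_same, Function.update_apply]
    split_ifs
    exacts [hz, h _ _]
  · rw [Store.write_ne _ hl]
    exact h _ _

/-- Started with memory `σ`, the program halts within its time bound, with bounded memory and the
postcondition satisfied. -/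
def WP (M : ℕ) (P : Prog) (Post : Store → Prop) (σ : Store) : Prop :=
  ∃ τ t, Exec P σ τ t ∧ t ≤ P.timeBound M ∧ Bounded M τ ∧ Post τ

theorem WP.mono {M : ℕ} {P : Prog} {Post Post' : Store → Prop} {σ : Store} (h : WP M P Post σ)
    (himp : ∀ τ, Bounded M τ → Post τ → Post' τ) : WP M P Post' σ := by
  obtain ⟨τ, t, h1, h2, h3, h4⟩ := h
  exact ⟨τ, t, h1, h2, h3, himp τ h3 h4⟩

theorem WP.nop {M : ℕ} {Post : Store → Prop} {σ : Store} (hσ : Bounded M σ) (h : Post σ) :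
    WP M .nop Post σ :=
  ⟨σ, 1, Exec.nop σ, le_rfl, hσ, h⟩

theorem WP.assign {M k : ℕ} {a e : Expr} {Post : Store → Prop} {σ : Store} (hσ : Bounded M σ)
    (he : bits (e.val σ) ≤ M) (h : Post (σ.write k (a.val σ) (e.val σ))) :
    WP M (.assign k a e) Post σ :=
  ⟨_, _, Exec.assign k a e σ,
    Nat.add_le_add_right (Nat.add_le_add (a.cost_le hσ) (e.cost_le hσ)) 1, hσ.write _ _ he, h⟩

/-- Boundedness of the intermediate memory is passed to the second program as a hypothesis, so that
it need not be part of any postcondition. -/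
theorem WP.seq {M : ℕ} {P Q : Prog} {Post : Store → Prop} {σ : Store}
    (h : WP M P (fun τ => Bounded M τ → WP M Q Post τ) σ) : WP M (.seq P Q) Post σ := by
  obtain ⟨τ, t, h1, h2, h3, h4⟩ := h
  obtain ⟨υ, u, k1, k2, k3, k4⟩ := h4 h3
  exact ⟨υ, t + u, h1.seq k1, Nat.add_le_add h2 k2, k3, k4⟩

theorem WP.branch {M : ℕ} {e : Expr} {P Q : Prog} {Post : Store → Prop} {σ : Store}
    (hσ : Bounded M σ) (hP : 0 < e.val σ → WP M P Post σ) (hQ : e.val σ ≤ 0 → WP M Q Post σ) :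
    WP M (.branch e P Q) Post σ := by
  have hc := e.cost_le hσ
  rcases lt_or_ge 0 (e.val σ) with h | h
  · obtain ⟨τ, t, h1, h2, h3, h4⟩ := hP h
    exact ⟨τ, _, Exec.branch_pos h h1, by simp only [Prog.timeBound]; omega, h3, h4⟩
  · obtain ⟨τ, t, h1, h2, h3, h4⟩ := hQ h
    exact ⟨τ, _, Exec.branch_nonpos h h1, by simp only [Prog.timeBound]; omega, h3, h4⟩

theorem WP.assign_of_eq {M k : ℕ} {a e : Expr} {Post : Store → Prop} {σ : Store} {x z : ℤ}
    (hσ : Bounded M σ) (ha : a.val σ = x) (he : e.val σ = z) (hz : bits z ≤ M)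
    (h : Post (σ.write k x z)) : WP M (.assign k a e) Post σ := by
  subst ha he
  exact WP.assign hσ hz h

theorem WP.branch_of_eq {M : ℕ} {e : Expr} {P Q : Prog} {Post : Store → Prop} {σ : Store} {z : ℤ}
    (hσ : Bounded M σ) (he : e.val σ = z) (hP : 0 < z → WP M P Post σ)
    (hQ : z ≤ 0 → WP M Q Post σ) : WP M (.branch e P Q) Post σ := by
  subst he
  exact WP.branch hσ hP hQ

theorem WP.loop {M K : ℕ} {e : Expr} {P : Prog} (I : ℕ → Store → Prop) {σ : Store} (hK : K ≤ M)
    (hσ : Bounded M σ) (hI : I 0 σ)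
    (hstep : ∀ i < K, ∀ τ, Bounded M τ → I i τ → 0 < e.val τ ∧ WP M P (I (i + 1)) τ)
    (hend : ∀ τ, Bounded M τ → I K τ → e.val τ ≤ 0) : WP M (.loop e P) (I K) σ := by
  -- Induction on the number `d` of remaining rounds; the factor `d + 1` also pays for the last,
  -- failing test.
  have key : ∀ d ≤ K, ∀ τ, Bounded M τ → I (K - d) τ → ∃ υ t, Exec (.loop e P) τ υ t ∧
      t ≤ (d + 1) * (e.costBound M + 1 + P.timeBound M) ∧ Bounded M υ ∧ I K υ := by
    intro d
    induction d with
    | zero =>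
      intro _ τ hτ hIτ
      have hc := e.cost_le hτ
      exact ⟨τ, _, Exec.loop_done (hend τ hτ hIτ), by omega, hτ, hIτ⟩
    | succ d ih =>
      intro hd τ hτ hIτ
      have hc := e.cost_le hτ
      obtain ⟨hpos, τ', t, h1, h2, h3, h4⟩ := hstep (K - (d + 1)) (by omega) τ hτ hIτ
      rw [show K - (d + 1) + 1 = K - d by omega] at h4
      obtain ⟨υ, u, k1, k2, k3, k4⟩ := ih (by omega) τ' h3 h4
      refine ⟨υ, _, Exec.loop_step hpos h1 k1, ?_, k3, k4⟩
      rw [add_mul (d + 1), one_mul]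
      omega
  obtain ⟨υ, t, h1, h2, h3, h4⟩ := key K le_rfl σ hσ (by simpa using hI)
  exact ⟨υ, t, h1, h2.trans (Nat.mul_le_mul_right _ (by omega)), h3, h4⟩

/-- The scalar stored in cell `0` of array `k`. -/
abbrev Expr.var (k : ℕ) : Expr := .cell k (.const 0)

/-- `for c = 0, …, hi - 1 do P`, with the counter in cell `0` of array `c`. -/
def Prog.for (c : ℕ) (hi : Expr) (P : Prog) : Prog :=
  .seq (.assign c (.const 0) (.const 0))
    (.loop (.sub hi (.var c)) (.seq P (.assign c (.const 0) (.add (.var c) (.const 1)))))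

/-- Rule for `for` loops with an invariant that does not mention the counter. -/
theorem WP.for {M K c : ℕ} {hi : Expr} {P : Prog} (I : ℕ → Store → Prop) {σ : Store} (hK : K ≤ M)
    (hσ : Bounded M σ) (hI : I 0 σ)
    (hc : ∀ i τ z, I i τ → I i (τ.write c 0 z))
    (hhi : ∀ i τ, I i τ → hi.val τ = K)
    (hstep : ∀ i < K, ∀ τ, Bounded M τ → τ c 0 = i → I i τ →
      WP M P (fun υ => υ c 0 = i ∧ I (i + 1) υ) τ) : WP M (.for c hi P) (I K) σ := by
  refine WP.seq (WP.assign hσ (by simp [Expr.val, bits]) fun hσ' => ?_)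
  refine (WP.loop (fun i τ => τ c 0 = i ∧ I i τ) hK hσ' ⟨?_, hc _ _ _ hI⟩ ?_ ?_).mono
    fun τ _ h => h.2
  · simp [Store.write_same, Expr.val]
  · rintro i hi' τ hτ ⟨h1, h2⟩
    refine ⟨by simp only [Expr.val, h1, hhi i τ h2]; omega, ?_⟩
    refine WP.seq ((hstep i hi' τ hτ h1 h2).mono fun υ _ h hυ => ?_)
    have hv : (Expr.add (.var c) (.const 1)).val υ = ((i + 1 : ℕ) : ℤ) := by
      simp [Expr.val, h.1]
    refine WP.assign hυ ?_ ⟨?_, hc _ _ _ h.2⟩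
    · rw [hv]; exact bits_natCast_le (by omega)
    · rw [hv]; simp [Store.write_same, Expr.val]
  · rintro τ _ ⟨h1, h2⟩
    simp [Expr.val, h1, hhi K τ h2]

/-! ### Bounds for the initial memory and passage to polynomial time -/

theorem length_le_wordSize (w : List ℤ) : w.length ≤ wordSize w := by
  induction w with
  | nil => simp
  | cons z w ih =>
    have h2 : wordSize (z :: w) = (bits z + 1) + wordSize w := rfl
    rw [List.length_cons, h2]
    omega

theorem initStore_bounded (w : List ℤ) {M : ℕ} (hM : wordSize w ≤ M) :
    Bounded M (initStore w) := by
  have h0 : bits 0 ≤ M := by simp [bits]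
  intro k a
  simp only [initStore]
  split_ifs with hk
  · simp only [wordArray]
    split_ifs with ha ha'
    · exact bits_natCast_le ((length_le_wordSize w).trans hM)
    · rcases lt_or_ge (a.toNat - 1) w.length with hl | hl
      · rw [List.getD_eq_getElem _ _ hl]
        refine le_trans ?_ hM
        have : bits w[a.toNat - 1] + 1 ≤ wordSize w :=
          List.le_sum_of_mem (List.mem_map.2 ⟨_, List.getElem_mem hl, rfl⟩)
        omega
      · rw [List.getD_eq_default _ _ hl]; exact h0
    · exact h0
  · exact h0

/-- A program whose memory stays linearly bounded solves a search problem in polynomial time. -/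
theorem polyTimeSolvable_of_wp {ι : Type} {enc : ι → List ℤ} {Correct : ι → List ℤ → Prop}
    (P : Prog) (h : ∀ I, WP (10 * wordSize (enc I) + 10) P
      (fun τ => ∃ y, Outputs τ y ∧ Correct I y) (initStore (enc I))) :
    PolyTimeSolvable enc Correct := by
  -- The polynomial is the syntactic time bound of `P` itself, taken in `ℕ[X]`.
  refine ⟨P, P.timeBound (10 * Polynomial.X + 10), fun I => ?_⟩
  obtain ⟨τ, t, h1, h2, h3, y, h4, h5⟩ := h I
  refine ⟨τ, t, y, h1, h2.trans_eq ?_, h4, h5⟩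
  have := P.map_timeBound (Polynomial.evalRingHom (wordSize (enc I))) (10 * Polynomial.X + 10)
  simpa using this.symm

/-! ### Linearization of the objective function -/

/-- The contribution of a historic solution to the scaled weight of an item. -/
def WSData.histTerm {n : ℕ} (D : WSData n) (Q : ℤ) (j : Fin n) (i : Fin D.N) : ℤ :=
  (D.α.den - D.α.num) * (D.lam i).num * (Q / (D.lam i).den) * (1 - 2 * ((D.hist i j).toNat : ℤ))

/-- Integral item weights: `Q` times the denominator of `α` times the coefficients of the linear
part of the objective function. -/
def WSData.weight {n : ℕ} (D : WSData n) (Q : ℤ) (j : Fin n) : ℤ :=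
  D.α.num * (D.c j).num * (Q / (D.c j).den) + if j ∈ D.imp then ∑ i, D.histTerm Q j i else 0

/-- Total weight of a binary vector. -/
def totalWeight {n : ℕ} (W : Fin n → ℤ) (x : Fin n → Bool) : ℤ := ∑ j, W j * ((x j).toNat : ℤ)

/-- The four cases of two bits show that the indicator of being different is affine in the first
bit; this makes the whole problem linear. -/
theorem hammingDist_chi {n : ℕ} (E' : Finset (Fin n)) (x y : Fin n → Bool) :
    (hammingDist (chi E' x) (chi E' y) : ℚ) =
      ∑ j, if j ∈ E' then ((y j).toNat : ℚ) + (1 - 2 * ((y j).toNat : ℚ)) * (x j).toNat else 0 := by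
  rw [Finset.sum_ite_mem, Finset.univ_inter, ← Finset.sum_coe_sort E', hammingDist,
    Finset.card_filter]
  push_cast
  refine Finset.sum_congr rfl fun j _ => ?_
  have key : ∀ a b : Bool, (if a ≠ b then (1 : ℚ) else 0) =
      (b.toNat : ℚ) + (1 - 2 * (b.toNat : ℚ)) * a.toNat := by
    intro a b
    cases a <;> cases b <;> norm_num
  exact (if_congr Iff.rfl rfl rfl).trans (key (x j) (y j))

theorem num_mul_div_den (q : ℚ) {Q : ℤ} (h : (q.den : ℤ) ∣ Q) :
    (q.num : ℚ) * ((Q / (q.den : ℤ) : ℤ) : ℚ) = Q * q := by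
  rw [Int.cast_div h (by exact_mod_cast q.den_nz)]
  conv_rhs => rw [← Rat.num_div_den q]
  push_cast
  ring

theorem WSData.weight_cast {n : ℕ} (D : WSData n) {Q : ℤ} (hc : ∀ j, ((D.c j).den : ℤ) ∣ Q)
    (hl : ∀ i, ((D.lam i).den : ℤ) ∣ Q) (j : Fin n) :
    (D.weight Q j : ℚ) = Q * D.α.den * (D.α * D.c j +
      if j ∈ D.imp then ∑ i, (1 - D.α) * D.lam i * (1 - 2 * ((D.hist i j).toNat : ℚ)) else 0) := by
  have hα : (D.α.num : ℚ) = D.α.den * D.α := by rw [mul_comm]; exact (Rat.mul_den_eq_num _).symm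
  have hterm : ∀ i, (D.histTerm Q j i : ℚ) =
      Q * D.α.den * ((1 - D.α) * D.lam i * (1 - 2 * ((D.hist i j).toNat : ℚ))) := by
    intro i
    simp only [WSData.histTerm]
    push_cast
    rw [mul_assoc ((D.α.den : ℚ) - _), num_mul_div_den _ (hl i), hα]
    ring
  simp only [WSData.weight]
  push_cast
  rw [mul_assoc (D.α.num : ℚ), num_mul_div_den _ (hc j), hα]
  simp only [hterm, ← Finset.mul_sum]
  rw [mul_add, mul_ite, mul_zero]
  congr 1
  ring

theorem WSData.exists_objective_eq {n : ℕ} (D : WSData n) {Q : ℤ}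
    (hc : ∀ j, ((D.c j).den : ℤ) ∣ Q) (hl : ∀ i, ((D.lam i).den : ℤ) ∣ Q) :
    ∃ C : ℚ, ∀ x, (Q * D.α.den : ℚ) * D.objective x = C + (totalWeight (D.weight Q) x : ℚ) := by
  -- The constant is the scaled objective at the zero vector, where only the historic solutions
  -- contribute.
  refine ⟨Q * D.α.den * ((1 - D.α) * ∑ i, D.lam i *
    ∑ j, if j ∈ D.imp then ((D.hist i j).toNat : ℚ) else 0), fun x => ?_⟩
  simp only [WSData.objective, totalWeight, hammingDist_chi]
  push_cast
  simp only [D.weight_cast hc hl, mul_assoc, ← Finset.mul_sum]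
  rw [← mul_add, ← mul_add]
  -- Membership in the important set becomes a factor, so that `ring` can treat the summands.
  obtain ⟨e, he⟩ : ∃ e : Fin n → ℚ, ∀ j a, (if j ∈ D.imp then a else 0) = e j * a :=
    ⟨fun j => if j ∈ D.imp then 1 else 0, by simp⟩
  have hswap : ∑ i, D.lam i * ∑ j, e j * ((1 - 2 * ((D.hist i j).toNat : ℚ)) * (x j).toNat) =
      ∑ j, e j * ((∑ i, D.lam i * (1 - 2 * ((D.hist i j).toNat : ℚ))) * (x j).toNat) := by
    simp only [Finset.mul_sum, Finset.sum_mul]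
    rw [Finset.sum_comm]
    exact Finset.sum_congr rfl fun j _ => Finset.sum_congr rfl fun i _ => by ring
  have hlin : ∑ j, (D.α * D.c j + e j * ((1 - D.α) *
        ∑ i, D.lam i * (1 - 2 * ((D.hist i j).toNat : ℚ)))) * (x j).toNat =
      D.α * ∑ j, D.c j * (x j).toNat +
        (1 - D.α) * ∑ j, e j * ((∑ i, D.lam i * (1 - 2 * ((D.hist i j).toNat : ℚ))) *
          (x j).toNat) := by
    simp only [Finset.mul_sum (s := Finset.univ (α := Fin n)), ← Finset.sum_add_distrib]
    exact Finset.sum_congr rfl fun j _ => by ring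
  simp only [he]
  rw [hlin, ← hswap]
  simp only [mul_add, Finset.sum_add_distrib]
  ring

/-- The map from the objective to the integral weight is affine with positive slope and so preserves
minimizers. -/
theorem WSData.isOptimal_of_totalWeight_le {n : ℕ} (D : WSData n) {Q : ℤ} (hQ : 0 < Q)
    (hc : ∀ j, ((D.c j).den : ℤ) ∣ Q) (hl : ∀ i, ((D.lam i).den : ℤ) ∣ Q)
    {X : Set (Fin n → Bool)} {x : Fin n → Bool} (hx : x ∈ X)
    (hmin : ∀ y ∈ X, totalWeight (D.weight Q) x ≤ totalWeight (D.weight Q) y) :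
    D.IsOptimal X x := by
  obtain ⟨C, hC⟩ := D.exists_objective_eq hc hl
  refine ⟨hx, fun y hy => ?_⟩
  have hpos : (0 : ℚ) < Q * D.α.den :=
    mul_pos (by exact_mod_cast hQ) (by exact_mod_cast D.α.den_pos)
  refine le_of_mul_le_mul_left ?_ hpos
  rw [hC, hC]
  exact add_le_add_right (by exact_mod_cast hmin y hy) C

/-! ### Layout of the input -/

/-- The word `l` occupies the cells from `a` on. -/
def Block (A : ℤ → ℤ) (a : ℤ) (l : List ℤ) : Prop := ∀ i : Fin l.length, A (a + (i : ℕ)) = l.get i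

theorem block_wordArray (w : List ℤ) : Block (wordArray w) 1 w := by
  intro i
  have h1 : (1 : ℤ) + (i : ℕ) ≠ 0 := by omega
  have h2 : (0 : ℤ) < 1 + (i : ℕ) := by omega
  have h3 : (1 + (i : ℕ) : ℤ).toNat - 1 = i := by omega
  simp [wordArray, h1, h2, h3]

theorem block_append {A : ℤ → ℤ} {a : ℤ} {l l' : List ℤ} :
    Block A a (l ++ l') ↔ Block A a l ∧ Block A (a + l.length) l' := by
  simp only [Block, Fin.forall_iff, List.length_append, List.get_eq_getElem]
  constructor
  · refine fun h => ⟨fun i hi => ?_, fun i hi => ?_⟩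
    · rw [h i (by omega), List.getElem_append_left hi]
    · have := h (l.length + i) (by omega)
      rw [List.getElem_append_right (by omega)] at this
      push_cast at this
      simpa [add_assoc] using this
  · rintro ⟨h, h'⟩ i hi
    rcases lt_or_ge i l.length with hl | hl
    · rw [List.getElem_append_left hl, h i hl]
    · rw [List.getElem_append_right hl, ← h' (i - l.length) (by omega)]
      congr 1
      omega

theorem block_ofFn {A : ℤ → ℤ} {a : ℤ} {k : ℕ} {f : Fin k → ℤ} :
    Block A a (List.ofFn f) ↔ ∀ j : Fin k, A (a + (j : ℕ)) = f j := by
  simp only [Block, Fin.forall_iff, List.length_ofFn, List.get_ofFn]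
  rfl

theorem block_cons {A : ℤ → ℤ} {a z : ℤ} {l : List ℤ} :
    Block A a (z :: l) ↔ A a = z ∧ Block A (a + 1) l := by
  rw [← List.singleton_append, block_append]
  simp [Block]

theorem block_nil {A : ℤ → ℤ} {a : ℤ} : Block A a [] := fun i => i.elim0

/-- The array `A` contains the graph. -/
structure GraphLayout {m n : ℕ} (A : ℤ → ℤ) (tail head : Fin n → Fin m) : Prop where
  vertices : A 1 = m
  edges : A 2 = n
  tails : ∀ j : Fin n, A (m + 3 + (j : ℕ)) = (tail j : ℕ)
  heads : ∀ j : Fin n, A (m + n + 3 + (j : ℕ)) = (head j : ℕ)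

/-- The array `A` contains the numerical data from cell `b` on. -/
structure DataLayout {n : ℕ} (A : ℤ → ℤ) (b : ℤ) (D : WSData n) : Prop where
  histories : A b = D.N
  α_num : A (b + 1) = D.α.num
  α_den : A (b + 2) = D.α.den
  c_num : ∀ j : Fin n, A (b + 3 + (j : ℕ)) = (D.c j).num
  c_den : ∀ j : Fin n, A (b + 3 + n + (j : ℕ)) = (D.c j).den
  lam_num : ∀ i : Fin D.N, A (b + 3 + 2 * n + (i : ℕ)) = (D.lam i).num
  lam_den : ∀ i : Fin D.N, A (b + 3 + 2 * n + D.N + (i : ℕ)) = (D.lam i).den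
  imp : ∀ j : Fin n, A (b + 3 + 2 * n + 2 * D.N + (j : ℕ)) = if j ∈ D.imp then 1 else 0
  hist : ∀ (i : Fin D.N) (j : Fin n),
    A (b + 3 + 3 * n + 2 * D.N + ((i : ℕ) * n + (j : ℕ))) = (D.hist i j).toNat

theorem graphLayout_of_block {m n : ℕ} {A : ℤ → ℤ} {tail head : Fin n → Fin m}
    (h : Block A 1 (encGraph tail head)) : GraphLayout A tail head := by
  simp only [encGraph, block_append, block_cons, block_ofFn, block_nil, and_true, List.length_append,
    List.length_cons, List.length_nil, List.length_ofFn] at h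
  obtain ⟨⟨⟨⟨h1, h2⟩, -⟩, h3⟩, h4⟩ := h
  refine ⟨h1, h2, fun j => ?_, fun j => ?_⟩
  · rw [← h3]; congr 1; push_cast; ring
  · rw [← h4]; congr 1; push_cast; ring

theorem dataLayout_of_block {n : ℕ} {A : ℤ → ℤ} {b : ℤ} {D : WSData n}
    (h : Block A b D.encode) : DataLayout A b D := by
  -- The historic solutions form a matrix stored row by row, so entry `(i, j)` has position `i * n +
  -- j`, as in `finProdFinEquiv`.
  have hh : (List.ofFn fun i => encVec (D.hist i)).flatten =
      List.ofFn fun k : Fin (D.N * n) => ((D.hist k.divNat k.modNat).toNat : ℤ) := by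
    rw [List.ofFn_mul]
    congr 2
    funext i
    simp only [encVec]
    congr 1
    funext j
    have e : (⟨i * n + j, (Nat.add_lt_add_left j.2 _).trans_le
        (by rw [← Nat.succ_mul]; exact Nat.mul_le_mul_right _ i.2)⟩ : Fin (D.N * n)) =
        finProdFinEquiv (i, j) := by
      ext; simp [finProdFinEquiv, add_comm, mul_comm]
    have e' := finProdFinEquiv.symm_apply_apply (i, j)
    simp only [finProdFinEquiv_symm_apply, Prod.mk.injEq] at e'
    rw [e, e'.1, e'.2]
  rw [WSData.encode, hh] at h
  simp only [encRats, encVec, block_append, block_cons, block_ofFn, block_nil, and_true,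
    List.length_append, List.length_cons, List.length_nil, List.length_ofFn] at h
  obtain ⟨⟨⟨⟨⟨h1, h2, h3⟩, h4, h5⟩, h6, h7⟩, h8⟩, h9⟩ := h
  refine ⟨h1, h2, ?_, fun j => ?_, fun j => ?_, fun i => ?_, fun i => ?_, fun j => ?_,
    fun i j => ?_⟩
  · rw [← h3]; congr 1; ring
  · rw [← h4]; rfl
  · rw [← h5]; rfl
  · rw [← h6]; congr 1; push_cast; ring
  · rw [← h7]; congr 1; push_cast; ring
  · have := h8 j
    rw [show (if j ∈ D.imp then (1 : ℤ) else 0) = ((decide (j ∈ D.imp)).toNat : ℤ) by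
      by_cases hj : j ∈ D.imp <;> simp [hj], ← this]
    congr 1; push_cast; ring
  · have := h9 (finProdFinEquiv (i, j))
    have e' := finProdFinEquiv.symm_apply_apply (i, j)
    simp only [finProdFinEquiv_symm_apply, Prod.mk.injEq] at e'
    rw [e'.1, e'.2] at this
    rw [← this]; congr 1; simp [finProdFinEquiv]; ring

/-! ### Programs for the item weights -/

instance : Add Expr := ⟨.add⟩
instance : Sub Expr := ⟨.sub⟩
instance : Mul Expr := ⟨.mul⟩
instance : Div Expr := ⟨.div⟩
instance (k : ℕ) : OfNat Expr k := ⟨.const k⟩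

@[simp] theorem Expr.val_add' (σ : Store) (e f : Expr) : (e + f).val σ = e.val σ + f.val σ := rfl
@[simp] theorem Expr.val_sub' (σ : Store) (e f : Expr) : (e - f).val σ = e.val σ - f.val σ := rfl
@[simp] theorem Expr.val_mul' (σ : Store) (e f : Expr) : (e * f).val σ = e.val σ * f.val σ := rfl
@[simp] theorem Expr.val_div' (σ : Store) (e f : Expr) : (e / f).val σ = e.val σ / f.val σ := rfl
@[simp] theorem Expr.val_ofNat (σ : Store) (k : ℕ) :
    (no_index (OfNat.ofNat k : Expr)).val σ = (OfNat.ofNat k : ℕ) := rfl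
@[simp] theorem Expr.val_cell (σ : Store) (k : ℕ) (a : Expr) :
    (Expr.cell k a).val σ = σ k (a.val σ) := rfl
@[simp] theorem Expr.val_const (σ : Store) (z : ℤ) : (Expr.const z).val σ = z := rfl

/-- A cell of the input array. -/
abbrev Expr.inp (a : Expr) : Expr := .cell 0 a

open ExplOpt.Expr in
/-- The product of all positive input letters, in cell `0` of array `3`. -/
def productProg : Prog :=
  .seq (.assign 3 0 1)
    (.for 4 (inp 0) (.branch (inp (var 4 + 1)) (.assign 3 0 (var 3 * inp (var 4 + 1))) .nop))

open ExplOpt.Expr in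
/-- The item weights, in array `2`; the numerical data start `d` cells after the lists of ends. -/
def weightProg (d : ℕ) : Prog :=
  let b : Expr := inp 1 + inp 2 + inp 2 + .const d
  let n : Expr := inp 2
  let N : Expr := inp b
  .for 4 n (.seq
    (.assign 2 (var 4) (inp (b + 1) * inp (b + 3 + var 4) * (var 3 / inp (b + 3 + n + var 4))))
    (.branch (inp (b + 3 + 2 * n + 2 * N + var 4))
      (.for 5 N (.assign 2 (var 4) (.cell 2 (var 4) +
        (inp (b + 2) - inp (b + 1)) * inp (b + 3 + 2 * n + var 5) *
          (var 3 / inp (b + 3 + 2 * n + N + var 5)) *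
          (1 - 2 * inp (b + 3 + 3 * n + 2 * N + (var 5 * n + var 4))))))
      .nop))

/-- The arrays that are not listed in `s` are unchanged. -/
def Frame (s : List ℕ) (σ τ : Store) : Prop := ∀ k, k ∉ s → τ k = σ k

theorem Frame.refl (s : List ℕ) (σ : Store) : Frame s σ σ := fun _ _ => rfl

theorem Frame.write {s : List ℕ} {σ τ : Store} (h : Frame s σ τ) {k : ℕ} (hk : k ∈ s) (a z : ℤ) :
    Frame s σ (τ.write k a z) := fun l hl => by
  rw [Store.write_ne _ (ne_of_mem_of_not_mem hk hl).symm, h l hl]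

theorem Frame.trans_of_subset {s t r : List ℕ} {σ τ υ : Store} (h : Frame s σ τ)
    (h' : Frame t τ υ) (hs : s ⊆ r) (ht : t ⊆ r) : Frame r σ υ := fun k hk => by
  rw [h' k fun hk' => hk (ht hk'), h k fun hk' => hk (hs hk')]

/-- The product of the positive letters of a word. -/
def letterProduct (w : List ℤ) : ℤ := (w.map fun z => if 0 < z then z else 1).prod

theorem letterProduct_pos (w : List ℤ) : 0 < letterProduct w :=
  List.prod_pos fun z hz => by
    obtain ⟨y, -, rfl⟩ := List.mem_map.1 hz
    split_ifs <;> omega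

/-- A letter `z` is less than `2 ^ bits z`, and the exponents add up to at most the word size. The
plain product is thus short enough, and no gcd has to be computed. -/
theorem letterProduct_le (w : List ℤ) : letterProduct w ≤ 2 ^ wordSize w := by
  induction w with
  | nil => simp [letterProduct, wordSize]
  | cons z w ih =>
    have h1 : letterProduct (z :: w) = (if 0 < z then z else 1) * letterProduct w := rfl
    have h2 : wordSize (z :: w) = (bits z + 1) + wordSize w := rfl
    rw [h1, h2, pow_add]
    have h3 : |z| < 2 ^ bits z := bits_le_iff.1 le_rfl
    have h4 : (1 : ℤ) ≤ 2 ^ bits z := one_le_pow₀ (by norm_num)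
    refine mul_le_mul ?_ ih (letterProduct_pos w).le (by positivity)
    rw [pow_succ]
    split_ifs
    · have := le_abs_self z
      omega
    · omega

theorem wordSize_take_le (w : List ℤ) (i : ℕ) : wordSize (w.take i) ≤ wordSize w := by
  conv_rhs => rw [← List.take_append_drop i w]
  simp only [wordSize, List.map_append, List.sum_append]
  omega

theorem dvd_letterProduct {w : List ℤ} {z : ℤ} (hz : z ∈ w) (hpos : 0 < z) :
    z ∣ letterProduct w :=
  List.dvd_prod (List.mem_map.2 ⟨z, hz, by simp [hpos]⟩)

theorem wp_productProg {M : ℕ} {σ : Store} {w : List ℤ} (hσ : Bounded M σ)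
    (hM : wordSize w < M) (h0 : σ 0 = wordArray w) :
    WP M productProg (fun τ => Frame [3, 4] σ τ ∧ τ 3 0 = letterProduct w) σ := by
  have hM1 : ∀ i, bits (letterProduct (w.take i)) ≤ M := fun i => by
    rw [bits_le_iff, abs_of_pos (letterProduct_pos _)]
    exact (letterProduct_le _).trans_lt
      (pow_lt_pow_right₀ (by norm_num) ((wordSize_take_le w i).trans_lt hM))
  refine WP.seq (WP.assign hσ ?_ fun hσ' => ?_)
  · simpa [letterProduct] using hM1 0
  refine (WP.for (fun i τ => Frame [3, 4] σ τ ∧ τ 3 0 = letterProduct (w.take i))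
    ((length_le_wordSize w).trans hM.le) hσ' ⟨?_, ?_⟩ ?_ ?_ ?_).mono fun τ _ h => ?_
  · exact (Frame.refl _ _).write (by simp) _ _
  · simp [Store.write_same, letterProduct]
  · rintro i τ z ⟨h1, h2⟩
    exact ⟨h1.write (by simp) _ _, by rw [Store.write_ne _ (by decide), h2]⟩
  · rintro i τ ⟨h1, -⟩
    simp [h1 0 (by simp), h0, wordArray]
  · rintro i hi τ hτ hc ⟨h1, h2⟩
    -- Cell `0` holds the length, so the letter with index `i` sits in cell `i + 1`.
    have hcell : (Expr.inp (Expr.var 4 + 1)).val τ = w[i] := by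
      have := block_wordArray w ⟨i, hi⟩
      simp [h1 0 (by simp), h0, hc]
      simpa [add_comm] using this
    have hstep : letterProduct (w.take (i + 1)) =
        letterProduct (w.take i) * if 0 < w[i] then w[i] else 1 := by
      simp only [letterProduct, List.take_succ_eq_append_getElem hi, List.map_append,
        List.prod_append, List.map_cons, List.map_nil, List.prod_singleton]
    refine WP.branch hτ (fun hpos => ?_) fun hneg => ?_
    · rw [hcell] at hpos
      have hval : (Expr.var 3 * Expr.inp (Expr.var 4 + 1)).val τ =
          letterProduct (w.take (i + 1)) := by
        rw [Expr.val_mul', hcell, hstep, if_pos hpos]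
        simp [h2]
      refine WP.assign hτ (by rw [hval]; exact hM1 _) ⟨?_, h1.write (by simp) _ _, ?_⟩
      · rw [Store.write_ne _ (by decide), hc]
      · rw [hval]; simp [Store.write_same]
    · rw [hcell] at hneg
      exact WP.nop hτ ⟨hc, h1, by rw [hstep, if_neg (by omega), mul_one, h2]⟩
  · simpa using h

/-! ### Size of the item weights and correctness of their computation -/

theorem abs_ediv_le_abs (a b : ℤ) : |a / b| ≤ |a| := by
  rw [Int.abs_eq_natAbs, Int.abs_eq_natAbs a]
  exact_mod_cast Int.natAbs_ediv_le_natAbs a b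

theorem WSData.abs_histTerm_le {n : ℕ} (D : WSData n) {Q : ℤ} {S : ℕ} (j : Fin n) (i : Fin D.N)
    (hα : |(D.α.den : ℤ) - D.α.num| ≤ 2 ^ S) (hl : |(D.lam i).num| ≤ 2 ^ S) (hQ : |Q| ≤ 2 ^ S) :
    |D.histTerm Q j i| ≤ 2 ^ (3 * S) := by
  have h1 := (abs_ediv_le_abs Q (D.lam i).den).trans hQ
  have h2 : |1 - 2 * ((D.hist i j).toNat : ℤ)| = 1 := by cases D.hist i j <;> rfl
  rw [WSData.histTerm, abs_mul, abs_mul, abs_mul, h2, mul_one,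
    show (2 : ℤ) ^ (3 * S) = 2 ^ S * 2 ^ S * 2 ^ S by ring]
  gcongr

theorem WSData.abs_weight_start_le {n : ℕ} (D : WSData n) {Q : ℤ} {S : ℕ} (j : Fin n)
    (hα : |D.α.num| ≤ 2 ^ S) (hc : |(D.c j).num| ≤ 2 ^ S) (hQ : |Q| ≤ 2 ^ S) :
    |D.α.num * (D.c j).num * (Q / (D.c j).den)| ≤ 2 ^ (3 * S) := by
  have h1 := (abs_ediv_le_abs Q (D.c j).den).trans hQ
  rw [abs_mul, abs_mul, show (2 : ℤ) ^ (3 * S) = 2 ^ S * 2 ^ S * 2 ^ S by ring]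
  gcongr

/-- The partial sums that occur in the computation of an item weight. -/
def WSData.partialWeight {n : ℕ} (D : WSData n) (Q : ℤ) (j : Fin n) (k : ℕ) : ℤ :=
  D.α.num * (D.c j).num * (Q / (D.c j).den) +
    ∑ i ∈ Finset.range k, if h : i < D.N then D.histTerm Q j ⟨i, h⟩ else 0

/-- Important and unimportant items are treated alike, so one bound on partial sums covers both the
intermediate and the final values. -/
theorem WSData.weight_eq_partialWeight {n : ℕ} (D : WSData n) (Q : ℤ) (j : Fin n) :
    D.weight Q j = D.partialWeight Q j (if j ∈ D.imp then D.N else 0) := by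
  simp only [WSData.weight, WSData.partialWeight]
  split_ifs
  · rw [Finset.sum_range]; simp
  · simp

/-- Each summand is a product of three factors of size at most `2 ^ S`, up to sign, and there are `k
+ 1 ≤ 2 ^ S` summands. -/
theorem WSData.abs_partialWeight_le {n : ℕ} (D : WSData n) {Q : ℤ} {S : ℕ} (j : Fin n) (k : ℕ)
    (hk : k < 2 ^ S) (hα : |D.α.num| ≤ 2 ^ S) (hα' : |(D.α.den : ℤ) - D.α.num| ≤ 2 ^ S)
    (hc : |(D.c j).num| ≤ 2 ^ S) (hl : ∀ i, |(D.lam i).num| ≤ 2 ^ S) (hQ : |Q| ≤ 2 ^ S) :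
    |D.partialWeight Q j k| ≤ 2 ^ (4 * S) := by
  have h1 : |∑ i ∈ Finset.range k, if h : i < D.N then D.histTerm Q j ⟨i, h⟩ else 0| ≤
      k * 2 ^ (3 * S) := by
    refine (Finset.abs_sum_le_sum_abs _ _).trans
      ((Finset.sum_le_card_nsmul _ _ (2 ^ (3 * S)) fun i _ => ?_).trans_eq (by simp))
    split_ifs with h
    · exact D.abs_histTerm_le j _ hα' (hl _) hQ
    · simp
  have h2 := D.abs_weight_start_le j hα hc hQ
  have h3 : ((k : ℤ) + 1) * 2 ^ (3 * S) ≤ 2 ^ S * 2 ^ (3 * S) :=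
    mul_le_mul_of_nonneg_right (by exact_mod_cast hk) (by positivity)
  calc _ ≤ _ := abs_add_le _ _
    _ ≤ ((k : ℤ) + 1) * 2 ^ (3 * S) := by linarith
    _ ≤ 2 ^ S * 2 ^ (3 * S) := h3
    _ = _ := by ring

/-- The lists of ends finish in cell `m + 2 * n + 2`. Hence `d` is `3` if the data follow at once,
and `5` if `s` and `t` come in between. -/
theorem wp_weightProg {m n d S : ℕ} {σ : Store} {A : ℤ → ℤ} {D : WSData n} {Q : ℤ}
    {tail head : Fin n → Fin m} (hG : GraphLayout A tail head)
    (hD : DataLayout A (m + n + n + d) D) (hσ : Bounded (10 * S + 10) σ) (h0 : σ 0 = A)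
    (hQ : σ 3 0 = Q) (hn : n ≤ S) (hN : D.N ≤ S)
    (hb : ∀ j k, |D.partialWeight Q j k| ≤ 2 ^ (4 * S) ∨ D.N < k) :
    WP (10 * S + 10) (weightProg d)
      (fun τ => Frame [2, 4, 5] σ τ ∧ ∀ j : Fin n, τ 2 (j : ℕ) = D.weight Q j) σ := by
  have hbits : ∀ j k, k ≤ D.N → bits (D.partialWeight Q j k) ≤ 10 * S + 10 := fun j k hk => by
    rw [bits_le_iff]
    exact ((hb j k).resolve_right (by omega)).trans_lt (pow_lt_pow_right₀ (by norm_num) (by omega))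
  refine (WP.for (fun i τ => Frame [2, 4, 5] σ τ ∧
    ∀ j : Fin n, (j : ℕ) < i → τ 2 (j : ℕ) = D.weight Q j) (K := n) (by omega) hσ
    ⟨Frame.refl _ _, fun j hj => by omega⟩ ?_ ?_ ?_).mono fun τ _ h => ⟨h.1, fun j => h.2 j j.2⟩
  · rintro i τ z ⟨h1, h2⟩
    exact ⟨h1.write (by simp) _ _, by rwa [Store.write_ne _ (by decide)]⟩
  · rintro i τ ⟨h1, -⟩
    simp [h1 0 (by simp), h0, hG.edges]
  rintro i hi τ hτ hc ⟨h1, h2⟩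
  obtain ⟨j, rfl⟩ : ∃ j : Fin n, (j : ℕ) = i := ⟨⟨i, hi⟩, rfl⟩
  refine WP.seq (WP.assign_of_eq (x := (j : ℕ)) (z := D.partialWeight Q j 0) hτ
    (by simp [hc]) ?_ (hbits j 0 (Nat.zero_le _)) fun hτ' => ?_)
  · simp [hc, h1 0, h1 3, h0, hG.vertices, hG.edges, hQ, hD.α_num, hD.c_num, hD.c_den,
      WSData.partialWeight]
  set υ := τ.write 2 (j : ℕ) (D.partialWeight Q j 0) with hυ
  have hυF : Frame [2, 4, 5] σ υ := h1.write (by simp) _ _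
  have hυ4 : υ 4 0 = (j : ℕ) := by rw [hυ, Store.write_ne _ (by decide), hc]
  have hυ2 : υ 2 (j : ℕ) = D.partialWeight Q j 0 := by simp [hυ, Store.write_same]
  have hυlt : ∀ l : Fin n, (l : ℕ) < j → υ 2 (l : ℕ) = D.weight Q l := fun l hl => by
    rw [hυ, Store.write_same, Function.update_of_ne (by omega), h2 l hl]
  refine WP.branch_of_eq (z := if j ∈ D.imp then 1 else 0) hτ' ?_ (fun hpos => ?_) fun hneg => ?_
  · simp [hυ4, hυF 0, h0, hG.vertices, hG.edges, hD.histories, hD.imp]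
  · have hj : j ∈ D.imp := by
      by_contra hj
      simp [hj] at hpos
    refine (WP.for (fun i ω => Frame [2, 4, 5] σ ω ∧ ω 4 0 = (j : ℕ) ∧
      ω 2 (j : ℕ) = D.partialWeight Q j i ∧
      ∀ l : Fin n, (l : ℕ) < j → ω 2 (l : ℕ) = D.weight Q l) (K := D.N) (by omega) hτ'
      ⟨hυF, hυ4, hυ2, hυlt⟩ ?_ ?_ ?_).mono ?_
    · rintro i ω z ⟨k1, k2, k3, k4⟩
      refine ⟨k1.write (by simp) _ _, ?_⟩
      rw [Store.write_ne _ (by decide), Store.write_ne _ (by decide)]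
      exact ⟨k2, k3, k4⟩
    · rintro i ω ⟨k1, -⟩
      simp [k1 0, h0, hG.vertices, hG.edges, hD.histories]
    · rintro i hi ω hω hωc ⟨k1, k2, k3, k4⟩
      have hT := hD.lam_num ⟨i, hi⟩
      have hT' := hD.lam_den ⟨i, hi⟩
      have hT'' := hD.hist ⟨i, hi⟩ j
      simp only at hT hT' hT''
      have hp : D.partialWeight Q j (i + 1) = D.partialWeight Q j i + D.histTerm Q j ⟨i, hi⟩ := by
        simp [WSData.partialWeight, Finset.sum_range_succ, hi, add_assoc]
      refine WP.assign_of_eq (x := (j : ℕ)) (z := D.partialWeight Q j (i + 1)) hω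
        (by simp [k2]) ?_ (hbits _ _ hi) ⟨?_, k1.write (by simp) _ _, ?_, ?_, fun l hl => ?_⟩
      · simp [k2, hωc, k3, k1 0, k1 3, h0, hQ, hG.vertices, hG.edges, hD.histories, hD.α_num,
          hD.α_den, hT, hT', hT'', hp, WSData.histTerm]
      · rw [Store.write_ne _ (by decide), hωc]
      · rw [Store.write_ne _ (by decide), k2]
      · simp [Store.write_same]
      · rw [Store.write_same, Function.update_of_ne (by omega), k4 l hl]
    · rintro ω - ⟨k1, k2, k3, k4⟩
      refine ⟨k2, k1, fun l hl => ?_⟩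
      rcases (Nat.lt_succ_iff_lt_or_eq.1 hl) with hl | hl
      · exact k4 l hl
      · rw [Fin.ext hl, k3, D.weight_eq_partialWeight, if_pos hj]
  · have hj : j ∉ D.imp := fun hj => by simp [hj] at hneg
    refine WP.nop hτ' ⟨hυ4, hυF, fun l hl => ?_⟩
    rcases (Nat.lt_succ_iff_lt_or_eq.1 hl) with hl | hl
    · exact hυlt l hl
    · rw [Fin.ext hl, hυ2, D.weight_eq_partialWeight, if_neg hj]

/-- Cells beyond the word contain `0`, so a nonzero content cannot be a default value. -/
theorem mem_of_wordArray_eq {w : List ℤ} {a z : ℤ} (h : wordArray w a = z) (ha : 0 < a)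
    (hz : z ≠ 0) : z ∈ w := by
  rw [wordArray, if_neg ha.ne', if_pos ha] at h
  rcases lt_or_ge (a.toNat - 1) w.length with hl | hl
  · rw [List.getD_eq_getElem _ _ hl] at h
    exact h ▸ List.getElem_mem hl
  · rw [List.getD_eq_default _ _ hl] at h
    exact absurd h.symm hz

/-- The denominators of the data divide the product of the positive input letters. -/
theorem DataLayout.den_dvd {n : ℕ} {w : List ℤ} {b : ℤ} {D : WSData n}
    (hD : DataLayout (wordArray w) b D) (hb : 0 < b) :
    (∀ j, ((D.c j).den : ℤ) ∣ letterProduct w) ∧ ∀ i, ((D.lam i).den : ℤ) ∣ letterProduct w := by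
  constructor
  · intro j
    have hpos : (0 : ℤ) < (D.c j).den := by exact_mod_cast (D.c j).den_pos
    exact dvd_letterProduct (mem_of_wordArray_eq (hD.c_den j) (by omega) hpos.ne') hpos
  · intro i
    have hpos : (0 : ℤ) < (D.lam i).den := by exact_mod_cast (D.lam i).den_pos
    exact dvd_letterProduct (mem_of_wordArray_eq (hD.lam_den i) (by omega) hpos.ne') hpos

theorem DataLayout.abs_partialWeight_le {n : ℕ} {w : List ℤ} {b : ℤ} {D : WSData n}
    (hD : DataLayout (wordArray w) b D) (hα : 0 < D.α) (hα' : D.α < 1) (hN : D.N ≤ wordSize w)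
    (j : Fin n) {k : ℕ} (hk : k ≤ D.N) :
    |D.partialWeight (letterProduct w) j k| ≤ 2 ^ (4 * wordSize w) := by
  have hA : ∀ a, |wordArray w a| ≤ 2 ^ wordSize w := fun a =>
    (bits_le_iff.1 (initStore_bounded w le_rfl 0 a)).le
  have h1 : 0 < D.α.num := Rat.num_pos.2 hα
  have h2 : D.α.num < D.α.den := by
    have := (Rat.lt_iff D.α 1).1 hα'
    simpa using this
  refine D.abs_partialWeight_le j k ((hk.trans hN).trans_lt Nat.lt_two_pow_self) ?_ ?_ ?_ ?_ ?_
  · exact hD.α_num ▸ hA _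
  -- Since `0 < α < 1`, the difference of denominator and numerator is positive and below the
  -- denominator, itself an input letter.
  · have := hD.α_den ▸ hA (b + 2)
    rw [abs_of_pos (by omega)] at this ⊢
    omega
  · exact hD.c_num j ▸ hA _
  · exact fun i => hD.lam_num i ▸ hA _
  · rw [abs_of_pos (letterProduct_pos w)]
    exact letterProduct_le w

theorem wp_prepare {m n d : ℕ} {w : List ℤ} {D : WSData n} {tail head : Fin n → Fin m}
    (hG : GraphLayout (wordArray w) tail head) (hD : DataLayout (wordArray w) (m + n + n + d) D)
    (hα : 0 < D.α) (hα' : D.α < 1) (hn : n ≤ wordSize w) (hN : D.N ≤ wordSize w) :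
    WP (10 * wordSize w + 10) (.seq productProg (weightProg d))
      (fun τ => Frame [2, 3, 4, 5] (initStore w) τ ∧
        ∀ j : Fin n, τ 2 (j : ℕ) = D.weight (letterProduct w) j) (initStore w) := by
  refine WP.seq ((wp_productProg (initStore_bounded w (by omega)) (by omega) rfl).mono
    fun τ hτ h _ => ?_)
  refine (wp_weightProg hG hD hτ (h.1 0 (by simp)) h.2 hn hN fun j k => ?_).mono fun υ _ h' =>
    ⟨h.1.trans_of_subset h'.1 (by simp) (by simp), h'.2⟩
  rcases le_or_gt k D.N with hk | hk
  · exact Or.inl (hD.abs_partialWeight_le hα hα' hN j hk)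
  · exact Or.inr hk

theorem DataLayout.abs_weight_le {n : ℕ} {w : List ℤ} {b : ℤ} {D : WSData n}
    (hD : DataLayout (wordArray w) b D) (hα : 0 < D.α) (hα' : D.α < 1) (hN : D.N ≤ wordSize w)
    (j : Fin n) : |D.weight (letterProduct w) j| ≤ 2 ^ (4 * wordSize w) := by
  rw [D.weight_eq_partialWeight]
  exact hD.abs_partialWeight_le hα hα' hN j (by split_ifs <;> omega)

/-! ### Walks in directed acyclic graphs -/

section Diwalk

variable {m n : ℕ} {tail head : Fin n → Fin m}

theorem IsDiwalk.reflTransGen {u v : Fin m} {p : List (Fin n)} (h : IsDiwalk tail head u p v) :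
    ∀ w ∈ u :: p.map head,
      Relation.ReflTransGen (fun a b => ∃ j, tail j = a ∧ head j = b) u w := by
  induction p generalizing u with
  | nil => simp [Relation.ReflTransGen.refl]
  | cons j p ih =>
    intro w hw
    rcases List.mem_cons.1 hw with rfl | hw
    · exact .refl
    · exact .head ⟨j, h.1, rfl⟩ (ih h.2 w hw)

/-- A return to the first vertex would close a directed cycle. Walks are therefore paths, and
minimizing over walks loses nothing. -/
theorem IsDiwalk.nodup (hac : IsAcyclicDigraph tail head) {u v : Fin m} {p : List (Fin n)}
    (h : IsDiwalk tail head u p v) : (u :: p.map head).Nodup := by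
  induction p generalizing u with
  | nil => simp
  | cons j p ih =>
    refine List.nodup_cons.2 ⟨fun hu => hac u ?_, ih h.2⟩
    exact .head' ⟨j, h.1, rfl⟩ (h.2.reflTransGen u hu)

theorem IsDiwalk.nodup_edges (hac : IsAcyclicDigraph tail head) {u v : Fin m} {p : List (Fin n)}
    (h : IsDiwalk tail head u p v) : p.Nodup :=
  (List.nodup_cons.1 (h.nodup hac)).2.of_map head

theorem IsDiwalk.length_le (hac : IsAcyclicDigraph tail head) {u v : Fin m} {p : List (Fin n)}
    (h : IsDiwalk tail head u p v) : p.length ≤ m := by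
  have := (h.nodup hac).length_le_card
  simp at this
  omega

theorem abs_sum_map_le {W : Fin n → ℤ} {C : ℤ} (hW : ∀ j, |W j| ≤ C) (p : List (Fin n)) :
    |(p.map W).sum| ≤ p.length * C := by
  induction p with
  | nil => simp
  | cons j p ih =>
    simp only [List.map_cons, List.sum_cons, List.length_cons]
    have := abs_add_le (W j) (p.map W).sum
    have := hW j
    push_cast
    linarith

theorem totalWeight_eq_sum_map {W : Fin n → ℤ} {x : Fin n → Bool} {p : List (Fin n)}
    (hp : p.Nodup) (hx : ∀ j, x j = true ↔ j ∈ p) : totalWeight W x = (p.map W).sum := by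
  rw [← List.sum_toFinset W hp, totalWeight, ← Finset.sum_filter_add_sum_filter_not _ (· ∈ p)]
  have h1 : ∑ j with j ∉ p, W j * ((x j).toNat : ℤ) = 0 :=
    Finset.sum_eq_zero fun j hj => by
      have : x j = false := by simpa [← hx] using hj
      simp [this]
  have h2 : (Finset.univ.filter (· ∈ p)) = p.toFinset := by ext; simp
  rw [h1, h2, add_zero]
  refine Finset.sum_congr rfl fun j hj => ?_
  have : x j = true := by simpa [hx] using hj
  simp [this]

/-- Every positive label `R v` is justified by a walk from `v` to `t` of weight `d v` with incidence
vector in row `v` of `row`. -/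
def LabelsSound (tail head : Fin n → Fin m) (W : Fin n → ℤ) (t : Fin m) (R d row : ℤ → ℤ) : Prop :=
  ∀ v : Fin m, 0 < R (v : ℕ) → ∃ p, IsDiwalk tail head v p t ∧ d (v : ℕ) = (p.map W).sum ∧
    ∀ j : Fin n, row ((v : ℕ) * n + (j : ℕ)) = if j ∈ p then 1 else 0

/-- The labels are at least as good as all walks to `t` with at most `r` edges, and as all those
with `r + 1` edges that start with one of the first `i` edges of the graph. -/
def LabelsGood (tail head : Fin n → Fin m) (W : Fin n → ℤ) (t : Fin m) (R d : ℤ → ℤ)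
    (r i : ℕ) : Prop :=
  ∀ (v : Fin m) (p : List (Fin n)), IsDiwalk tail head v p t →
    (p.length ≤ r ∨ p.length ≤ r + 1 ∧ ∃ j ∈ p.head?, (j : ℕ) < i) →
      0 < R (v : ℕ) ∧ d (v : ℕ) ≤ (p.map W).sum

/-- The first edge of a nonempty walk is among the `n` edges, so a full sweep covers all walks with
one more edge. -/
theorem LabelsGood.next_round {W : Fin n → ℤ} {t : Fin m} {R d : ℤ → ℤ} {r : ℕ}
    (h : LabelsGood tail head W t R d r n) : LabelsGood tail head W t R d (r + 1) 0 := by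
  intro v p hp hlen
  refine h v p hp ?_
  cases p with
  | nil => simp
  | cons j p =>
    right
    rcases hlen with hlen | ⟨-, j, -, hj⟩
    · exact ⟨hlen, j, by simp, j.2⟩
    · omega

/-- Labels that are no worse than before and that respect edge `i` are good for one more edge. -/
theorem LabelsGood.next_edge {W : Fin n → ℤ} {t : Fin m} {R d R' d' : ℤ → ℤ} {r : ℕ} {j : Fin n}
    (h : LabelsGood tail head W t R d r j)
    (hmono : ∀ v : Fin m, 0 < R (v : ℕ) → 0 < R' (v : ℕ) ∧ d' (v : ℕ) ≤ d (v : ℕ))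
    (hedge : 0 < R (head j : ℕ) →
      0 < R' (tail j : ℕ) ∧ d' (tail j : ℕ) ≤ d (head j : ℕ) + W j) :
    LabelsGood tail head W t R' d' r (j + 1) := by
  have old : ∀ v p, IsDiwalk tail head v p t →
      (p.length ≤ r ∨ p.length ≤ r + 1 ∧ ∃ j' ∈ p.head?, (j' : ℕ) < j) →
      0 < R' (v : ℕ) ∧ d' (v : ℕ) ≤ (p.map W).sum := fun v p hp hlen => by
    obtain ⟨h1, h2⟩ := h v p hp hlen
    exact ⟨(hmono v h1).1, (hmono v h1).2.trans h2⟩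
  rintro v p hp (hlen | ⟨hlen, l, hl, hlj⟩)
  · exact old v p hp (Or.inl hlen)
  rcases Nat.lt_succ_iff_lt_or_eq.1 hlj with hlj | hlj
  · exact old v p hp (Or.inr ⟨hlen, l, hl, hlj⟩)
  obtain rfl : l = j := Fin.ext hlj
  cases p with
  | nil => simp at hl
  | cons a p =>
    obtain rfl : a = l := by simpa using hl
    obtain ⟨h1, h2⟩ := h (head a) p hp.2 (Or.inl (by simpa using hlen))
    obtain ⟨h3, h4⟩ := hedge h1
    obtain rfl := hp.1
    refine ⟨h3, h4.trans ?_⟩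
    simp only [List.map_cons, List.sum_cons]
    omega

/-- The new walk from the tail is `j` followed by the stored walk from the head. Every vertex owns a
full copy of its incidence vector, so overwriting one row leaves the other certificates intact;
predecessor pointers would not give this. -/
theorem LabelsSound.update {W : Fin n → ℤ} {t : Fin m} {R d row R' d' row' : ℤ → ℤ} {j : Fin n}
    (h : LabelsSound tail head W t R d row)
    (hj : 0 < R (head j : ℕ)) (hd : d' (tail j : ℕ) = d (head j : ℕ) + W j)
    (hrow : ∀ k : Fin n, row' ((tail j : ℕ) * n + (k : ℕ)) =
      if k = j then 1 else row ((head j : ℕ) * n + (k : ℕ)))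
    (hR_ne : ∀ v : Fin m, v ≠ tail j → R' (v : ℕ) = R (v : ℕ))
    (hd_ne : ∀ v : Fin m, v ≠ tail j → d' (v : ℕ) = d (v : ℕ))
    (hrow_ne : ∀ v : Fin m, v ≠ tail j → ∀ k : Fin n,
      row' ((v : ℕ) * n + (k : ℕ)) = row ((v : ℕ) * n + (k : ℕ))) :
    LabelsSound tail head W t R' d' row' := by
  intro v hv
  by_cases hvj : v = tail j
  · obtain ⟨p, hp, hdp, hrp⟩ := h (head j) hj
    subst hvj
    have hw : IsDiwalk tail head (tail j) (j :: p) t := ⟨rfl, hp⟩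
    refine ⟨j :: p, hw, by rw [hd, hdp]; simp [add_comm], fun k => ?_⟩
    rw [hrow, hrp]
    by_cases hk : k = j <;> simp [hk]
  · rw [hR_ne v hvj] at hv
    obtain ⟨p, hp, hdp, hrp⟩ := h v hv
    exact ⟨p, hp, by rw [hd_ne v hvj, hdp], fun k => by rw [hrow_ne v hvj, hrp]⟩

/-- Row-major addresses do not collide because column indices are below `n`; writes to one row thus
leave all others alone. -/
theorem row_index_injective {u v : Fin m} {k l : Fin n}
    (h : ((u : ℕ) : ℤ) * n + (k : ℕ) = ((v : ℕ) : ℤ) * n + (l : ℕ)) : u = v ∧ k = l := by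
  have : finProdFinEquiv (u, k) = finProdFinEquiv (v, l) := by
    ext
    simp only [finProdFinEquiv_apply_val]
    zify
    linarith
  simpa using this

end Diwalk

/-! ### A program for shortest paths -/

section Dag

open ExplOpt.Expr

/-- The first end of the edge with index `j`. -/
def Expr.tailOf (j : Expr) : Expr := inp (inp 1 + 3 + j)

/-- The second end of the edge with index `j`. -/
def Expr.headOf (j : Expr) : Expr := inp (inp 1 + inp 2 + 3 + j)

/-- Prepend the edge with index in cell `0` of array `5` to the best walk from its head. -/
def prependProg : Prog :=
  let j : Expr := var 5
  -- Array `7` flags the vertices with a known walk, array `8` holds the weights, and array `9` the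
  -- incidence vectors, `n` cells per vertex.
  .seq (.assign 7 (tailOf j) 1)
    (.seq (.assign 8 (tailOf j) (.cell 8 (headOf j) + .cell 2 j))
      (.seq (.for 6 (inp 2) (.assign 9 (tailOf j * inp 2 + var 6)
          (.cell 9 (headOf j * inp 2 + var 6))))
        (.assign 9 (tailOf j * inp 2 + j) 1)))

/-- Prepend an edge if this gives a better walk. -/
def relaxProg : Prog :=
  let j : Expr := var 5
  .branch (.cell 7 (headOf j))
    (.branch (.cell 7 (tailOf j))
      (.branch (.cell 8 (tailOf j) - .cell 8 (headOf j) - .cell 2 j) prependProg .nop)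
      prependProg)
    .nop

/-- Best walks to the vertex `t` from all vertices. -/
def walksProg : Prog :=
  .seq (.assign 7 (inp (inp 1 + inp 2 + inp 2 + 4)) 1)
    (.for 4 (inp 1) (.for 5 (inp 2) relaxProg))

/-- Output of the row of vertex `s`. -/
def outputRowProg : Prog :=
  .seq (.assign 1 0 (inp 2))
    (.for 4 (inp 2) (.assign 1 (var 4 + 1)
      (.cell 9 (inp (inp 1 + inp 2 + inp 2 + 3) * inp 2 + var 4))))

variable {m n : ℕ} {tail head : Fin n → Fin m} {A : ℤ → ℤ}

theorem GraphLayout.val_tailOf (hG : GraphLayout A tail head) {τ : Store} (h0 : τ 0 = A)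
    {j : Fin n} {e : Expr} (he : e.val τ = (j : ℕ)) : (tailOf e).val τ = (tail j : ℕ) := by
  simp [tailOf, h0, hG.vertices, he, hG.tails]

theorem GraphLayout.val_headOf (hG : GraphLayout A tail head) {τ : Store} (h0 : τ 0 = A)
    {j : Fin n} {e : Expr} (he : e.val τ = (j : ℕ)) : (headOf e).val τ = (head j : ℕ) := by
  simp [headOf, h0, hG.vertices, hG.edges, he, hG.heads]

theorem wp_prependProg {M : ℕ} {σ : Store} {W : Fin n → ℤ} {j : Fin n}
    (hG : GraphLayout A tail head) (hσ : Bounded M σ) (h0 : σ 0 = A) (hM : 1 ≤ M) (hn : n ≤ M)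
    (hj : σ 5 0 = (j : ℕ)) (hW : σ 2 (j : ℕ) = W j)
    (hb : bits (σ 8 (head j : ℕ) + W j) ≤ M) :
    WP M prependProg (fun τ => Frame [6, 7, 8, 9] σ τ ∧
      τ 7 = Function.update (σ 7) (tail j : ℕ) 1 ∧
      τ 8 = Function.update (σ 8) (tail j : ℕ) (σ 8 (head j : ℕ) + W j) ∧
      (∀ k : Fin n, τ 9 ((tail j : ℕ) * n + (k : ℕ)) =
        if k = j then 1 else σ 9 ((head j : ℕ) * n + (k : ℕ))) ∧
      ∀ v : Fin m, v ≠ tail j → ∀ k : Fin n,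
        τ 9 ((v : ℕ) * n + (k : ℕ)) = σ 9 ((v : ℕ) * n + (k : ℕ))) σ := by
  have hone : bits 1 ≤ M := by simpa [bits] using hM
  have ht : ∀ τ : Store, Frame [6, 7, 8, 9] σ τ → (tailOf (var 5)).val τ = (tail j : ℕ) :=
    fun τ h => hG.val_tailOf ((h 0 (by simp)).trans h0) (by simp [h 5 (by simp), hj])
  have hh : ∀ τ : Store, Frame [6, 7, 8, 9] σ τ → (headOf (var 5)).val τ = (head j : ℕ) :=
    fun τ h => hG.val_headOf ((h 0 (by simp)).trans h0) (by simp [h 5 (by simp), hj])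
  have hF := Frame.refl [6, 7, 8, 9] σ
  refine WP.seq (WP.assign_of_eq (z := 1) hσ (ht _ hF) (by simp) hone fun hσ1 => ?_)
  have hF1 := hF.write (k := 7) (by simp) (tail j : ℕ) 1
  set σ1 := σ.write 7 (tail j : ℕ) 1 with hσ1'
  refine WP.seq (WP.assign_of_eq (z := σ 8 (head j : ℕ) + W j) hσ1 (ht _ hF1) ?_ hb fun hσ2 => ?_)
  · have h18 : σ1 8 = σ 8 := Store.write_ne _ (by decide) _ _
    simp [hh _ hF1, hF1 5, hF1 2, hj, hW, h18]
  have hF2 := hF1.write (k := 8) (by simp) (tail j : ℕ) (σ 8 (head j : ℕ) + W j)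
  set σ2 := σ1.write 8 (tail j : ℕ) (σ 8 (head j : ℕ) + W j) with hσ2'
  have h27 : σ2 7 = Function.update (σ 7) (tail j : ℕ) 1 := by
    rw [hσ2', Store.write_ne _ (by decide), hσ1', Store.write_same]
  have h28 : σ2 8 = Function.update (σ 8) (tail j : ℕ) (σ 8 (head j : ℕ) + W j) := by
    rw [hσ2', Store.write_same, hσ1', Store.write_ne _ (by decide)]
  have h29 : σ2 9 = σ 9 := by
    rw [hσ2', Store.write_ne _ (by decide), hσ1', Store.write_ne _ (by decide)]
  refine WP.seq ((WP.for (fun i τ => Frame [6, 9] σ2 τ ∧ ∀ (v : Fin m) (k : Fin n),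
    τ 9 ((v : ℕ) * n + (k : ℕ)) = if v = tail j ∧ (k : ℕ) < i
      then σ 9 ((head j : ℕ) * n + (k : ℕ)) else σ 9 ((v : ℕ) * n + (k : ℕ))) (K := n) hn hσ2
    ⟨Frame.refl _ _, by simp [h29]⟩ ?_ ?_ ?_).mono ?_)
  · rintro i τ z ⟨h1, h2⟩
    exact ⟨h1.write (by simp) _ _, by rwa [Store.write_ne _ (by decide)]⟩
  · rintro i τ ⟨h1, -⟩
    simp [h1 0 (by simp), hF2 0 (by simp), h0, hG.edges]
  · rintro i hi τ hτ hc ⟨h1, h2⟩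
    obtain ⟨l, rfl⟩ : ∃ l : Fin n, (l : ℕ) = i := ⟨⟨i, hi⟩, rfl⟩
    have hF' : Frame [6, 7, 8, 9] σ τ := hF2.trans_of_subset h1 (by simp) (by simp)
    -- Entry `l` of the source row has not been overwritten yet; this would hold even if tail and
    -- head coincided.
    have hval : τ 9 ((head j : ℕ) * n + (l : ℕ)) = σ 9 ((head j : ℕ) * n + (l : ℕ)) := by
      rw [h2, if_neg (by simp)]
    refine WP.assign_of_eq (x := (tail j : ℕ) * n + (l : ℕ))
      (z := σ 9 ((head j : ℕ) * n + (l : ℕ))) hτ ?_ ?_ (hσ _ _)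
      ⟨?_, h1.write (by simp) _ _, fun v k => ?_⟩
    · simp [ht _ hF', hF' 0, h0, hG.edges, hc]
    · simp [hh _ hF', hF' 0, h0, hG.edges, hc, hval]
    · rw [Store.write_ne _ (by decide), hc]
    · rw [Store.write_same, Function.update_apply]
      split_ifs with c1 c2 c2
      · rw [(row_index_injective c1).2]
      · obtain ⟨rfl, rfl⟩ := row_index_injective c1
        simp at c2
      · have hkl : (k : ℕ) ≠ l := fun e => c1 (by rw [c2.1, e])
        rw [h2, if_pos ⟨c2.1, by omega⟩]
      · rw [h2, if_neg fun c => c2 ⟨c.1, by omega⟩]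
  · rintro τ hτ ⟨h1, h2⟩ -
    have hF' : Frame [6, 7, 8, 9] σ τ := hF2.trans_of_subset h1 (by simp) (by simp)
    refine WP.assign_of_eq (x := (tail j : ℕ) * n + (j : ℕ)) (z := 1) hτ ?_ (by simp) hone
      ⟨hF'.write (by simp) _ _, ?_, ?_, fun k => ?_, fun v hv k => ?_⟩
    · simp [ht _ hF', hF' 0, hF' 5, h0, hG.edges, hj]
    · rw [Store.write_ne _ (by decide), h1 7 (by simp), h27]
    · rw [Store.write_ne _ (by decide), h1 8 (by simp), h28]
    · rw [Store.write_same, Function.update_apply]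
      by_cases hk : k = j
      · simp [hk]
      · rw [if_neg fun e => hk (row_index_injective e).2, if_neg hk, h2, if_pos ⟨rfl, k.2⟩]
    · rw [Store.write_same, Function.update_of_ne fun e => hv (row_index_injective e).1, h2,
        if_neg fun c => hv c.1]

theorem wp_relaxProg {M r : ℕ} {C : ℤ} {σ : Store} {W : Fin n → ℤ} {t : Fin m} {j : Fin n}
    (hG : GraphLayout A tail head) (hac : IsAcyclicDigraph tail head) (hσ : Bounded M σ)
    (h0 : σ 0 = A) (hM : 1 ≤ M) (hn : n ≤ M) (hj : σ 5 0 = (j : ℕ))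
    (hW : ∀ j : Fin n, σ 2 (j : ℕ) = W j) (hWC : ∀ j, |W j| ≤ C) (hC : (m + 1) * C < 2 ^ M)
    (hsound : LabelsSound tail head W t (σ 7) (σ 8) (σ 9))
    (hgood : LabelsGood tail head W t (σ 7) (σ 8) r j) :
    WP M relaxProg (fun τ => Frame [6, 7, 8, 9] σ τ ∧
      LabelsSound tail head W t (τ 7) (τ 8) (τ 9) ∧
      LabelsGood tail head W t (τ 7) (τ 8) r (j + 1)) σ := by
  have ht : (tailOf (var 5)).val σ = (tail j : ℕ) := hG.val_tailOf h0 (by simp [hj])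
  have hh : (headOf (var 5)).val σ = (head j : ℕ) := hG.val_headOf h0 (by simp [hj])
  have hprepend : 0 < σ 7 (head j : ℕ) →
      (0 < σ 7 (tail j : ℕ) → σ 8 (head j : ℕ) + W j ≤ σ 8 (tail j : ℕ)) →
      WP M prependProg (fun τ => Frame [6, 7, 8, 9] σ τ ∧
        LabelsSound tail head W t (τ 7) (τ 8) (τ 9) ∧
        LabelsGood tail head W t (τ 7) (τ 8) r (j + 1)) σ := by
    intro hR hle
    -- By soundness the label of the head is the weight of a walk with at most `m` edges, so the new
    -- label is a sum of at most `m + 1` weights.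
    have hbits : bits (σ 8 (head j : ℕ) + W j) ≤ M := by
      obtain ⟨p, hp, hd, -⟩ := hsound _ hR
      have h1 := abs_sum_map_le hWC p
      have h2 : (p.length : ℤ) * C ≤ m * C :=
        mul_le_mul_of_nonneg_right (by exact_mod_cast hp.length_le hac)
          ((abs_nonneg _).trans (hWC j))
      have h3 := abs_add_le (p.map W).sum (W j)
      rw [bits_le_iff, hd]
      linarith [hWC j]
    refine (wp_prependProg hG hσ h0 hM hn hj (hW j) hbits).mono ?_
    rintro τ - ⟨h1, h7, h8, h9, h9'⟩
    have hu : ∀ v : Fin m, v ≠ tail j → ((v : ℕ) : ℤ) ≠ (tail j : ℕ) := fun v hv e =>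
      hv (Fin.ext (by exact_mod_cast e))
    refine ⟨h1, hsound.update hR (by simp [h8]) h9 (fun v hv => ?_) (fun v hv => ?_) h9',
      hgood.next_edge (fun v hv => ?_) fun _ => by simp [h7, h8]⟩
    · rw [h7, Function.update_of_ne (hu v hv)]
    · rw [h8, Function.update_of_ne (hu v hv)]
    · by_cases hvj : v = tail j
      · subst hvj
        simp [h7, h8, hle hv]
      · rw [h7, h8, Function.update_of_ne (hu v hvj), Function.update_of_ne (hu v hvj)]
        exact ⟨hv, le_rfl⟩
  refine WP.branch_of_eq (z := σ 7 (head j : ℕ)) hσ (by simp [hh]) (fun hR => ?_) fun hR => ?_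
  · refine WP.branch_of_eq (z := σ 7 (tail j : ℕ)) hσ (by simp [ht]) (fun hR' => ?_) fun hR' => ?_
    · refine WP.branch_of_eq (z := σ 8 (tail j : ℕ) - σ 8 (head j : ℕ) - W j) hσ
        (by simp [ht, hh, hj, hW]) (fun hlt => hprepend hR fun _ => by omega) fun hle => ?_
      exact WP.nop hσ ⟨Frame.refl _ _, hsound, hgood.next_edge (fun v hv => ⟨hv, le_rfl⟩)
        fun _ => ⟨hR', by omega⟩⟩
    · exact hprepend hR fun h => by omega
  · exact WP.nop hσ ⟨Frame.refl _ _, hsound, hgood.next_edge (fun v hv => ⟨hv, le_rfl⟩)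
      fun h => by omega⟩

theorem wp_walksProg {M : ℕ} {C : ℤ} {σ : Store} {W : Fin n → ℤ} {t : Fin m}
    (hG : GraphLayout A tail head) (hac : IsAcyclicDigraph tail head) (hσ : Bounded M σ)
    (h0 : σ 0 = A) (ht : A (m + n + n + 4) = (t : ℕ)) (hM : 1 ≤ M) (hn : n ≤ M) (hm : m ≤ M)
    (hW : ∀ j : Fin n, σ 2 (j : ℕ) = W j) (hWC : ∀ j, |W j| ≤ C) (hC : (m + 1) * C < 2 ^ M)
    (h7 : σ 7 = fun _ => 0) (h8 : σ 8 = fun _ => 0) (h9 : σ 9 = fun _ => 0) :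
    WP M walksProg (fun τ => Frame [4, 5, 6, 7, 8, 9] σ τ ∧
      LabelsSound tail head W t (τ 7) (τ 8) (τ 9) ∧
      LabelsGood tail head W t (τ 7) (τ 8) m 0) σ := by
  have hone : bits 1 ≤ M := by simpa [bits] using hM
  refine WP.seq (WP.assign_of_eq (x := (t : ℕ)) (z := 1) hσ ?_ (by simp) hone fun hσ1 => ?_)
  · simp [h0, hG.vertices, hG.edges, ht]
  have hF1 := (Frame.refl [4, 5, 6, 7, 8, 9] σ).write (k := 7) (by simp) (t : ℕ) 1
  refine WP.for (fun i τ => Frame [4, 5, 6, 7, 8, 9] σ τ ∧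
    LabelsSound tail head W t (τ 7) (τ 8) (τ 9) ∧
    LabelsGood tail head W t (τ 7) (τ 8) i 0) (K := m) hm hσ1 ⟨hF1, ?_, ?_⟩ ?_ ?_ ?_
  -- Initially only `t` is flagged, justified by the empty walk: its weight and incidence vector are
  -- the zeros already in memory.
  · intro v hv
    rw [Store.write_same, Function.update_apply, h7] at hv
    have hvt : v = t := by
      by_contra hne
      rw [if_neg fun e => hne (Fin.ext (by exact_mod_cast e))] at hv
      exact hv.false
    exact ⟨[], hvt, by simp [Store.write_ne, h8], by simp [Store.write_ne, h9]⟩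
  · intro v p hp hlen
    have hp0 : p = [] := by
      rcases hlen with hlen | ⟨-, j, -, hj⟩
      · simpa using hlen
      · omega
    subst hp0
    obtain rfl : v = t := hp
    simp [Store.write_same, Store.write_ne, h8]
  · rintro i τ z ⟨k1, k2⟩
    refine ⟨k1.write (by simp) _ _, ?_⟩
    rwa [Store.write_ne _ (by decide), Store.write_ne _ (by decide), Store.write_ne _ (by decide)]
  · rintro i τ ⟨k1, -⟩
    simp [k1 0 (by simp), h0, hG.vertices]
  · rintro r - τ hτ hc ⟨k1, k2, k3⟩
    refine (WP.for (fun i υ => Frame [4, 5, 6, 7, 8, 9] σ υ ∧ υ 4 0 = (r : ℕ) ∧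
      LabelsSound tail head W t (υ 7) (υ 8) (υ 9) ∧
      LabelsGood tail head W t (υ 7) (υ 8) r i) (K := n) hn hτ ⟨k1, hc, k2, k3⟩ ?_ ?_ ?_).mono ?_
    · rintro i υ z ⟨l1, l2⟩
      refine ⟨l1.write (by simp) _ _, ?_⟩
      rwa [Store.write_ne _ (by decide), Store.write_ne _ (by decide),
        Store.write_ne _ (by decide), Store.write_ne _ (by decide)]
    · rintro i υ ⟨l1, -⟩
      simp [l1 0 (by simp), h0, hG.edges]
    · rintro i hi υ hυ hcυ ⟨l1, l2, l3, l4⟩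
      obtain ⟨j, rfl⟩ : ∃ j : Fin n, (j : ℕ) = i := ⟨⟨i, hi⟩, rfl⟩
      refine (wp_relaxProg hG hac hυ ((l1 0 (by simp)).trans h0) hM hn hcυ
        (fun j => by rw [l1 2 (by simp), hW]) hWC hC l3 l4).mono fun ω _ h => ?_
      refine ⟨by rw [h.1 5 (by simp), hcυ], l1.trans_of_subset h.1 (by simp) (by simp), ?_, h.2⟩
      rw [h.1 4 (by simp), l2]
    · rintro υ - ⟨l1, l2, l3, l4⟩
      exact ⟨l2, l1, l3, l4.next_round⟩

theorem outputs_encVec {τ : Store} {x : Fin n → Bool} (h0 : τ 1 0 = n)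
    (hx : ∀ j : Fin n, τ 1 ((j : ℕ) + 1) = (x j).toNat) : Outputs τ (encVec x) := by
  refine ⟨by simpa [encVec] using h0, fun i => ?_⟩
  exact (hx (i.cast (by simp [encVec]))).trans (List.get_ofFn _ i).symm

theorem wp_outputRowProg {M : ℕ} {σ : Store} {s : Fin m} {x : Fin n → Bool}
    (hG : GraphLayout A tail head) (hσ : Bounded M σ) (h0 : σ 0 = A) (hn : n ≤ M)
    (hs : A (m + n + n + 3) = (s : ℕ))
    (hx : ∀ j : Fin n, σ 9 ((s : ℕ) * n + (j : ℕ)) = (x j).toNat) :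
    WP M outputRowProg (fun τ => Outputs τ (encVec x)) σ := by
  refine WP.seq (WP.assign_of_eq (x := 0) (z := n) hσ (by simp) (by simp [h0, hG.edges])
    (bits_natCast_le hn) fun hσ1 => ?_)
  refine (WP.for (fun i τ => Frame [1, 4] σ τ ∧ τ 1 0 = n ∧
    ∀ j : Fin n, (j : ℕ) < i → τ 1 ((j : ℕ) + 1) = (x j).toNat) (K := n) hn hσ1
    ⟨(Frame.refl _ _).write (by simp) _ _, by simp [Store.write_same], by simp⟩ ?_ ?_ ?_).mono
    fun τ _ h => outputs_encVec h.2.1 fun j => h.2.2 j j.2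
  · rintro i τ z ⟨h1, h2⟩
    exact ⟨h1.write (by simp) _ _, by rwa [Store.write_ne _ (by decide)]⟩
  · rintro i τ ⟨h1, -⟩
    simp [h1 0 (by simp), h0, hG.edges]
  · rintro i hi τ hτ hc ⟨h1, h2, h3⟩
    obtain ⟨j, rfl⟩ : ∃ j : Fin n, (j : ℕ) = i := ⟨⟨i, hi⟩, rfl⟩
    refine WP.assign_of_eq (x := (j : ℕ) + 1) (z := (x j).toNat) hτ (by simp [hc]) ?_ ?_
      ⟨?_, h1.write (by simp) _ _, ?_, fun k hk => ?_⟩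
    · simp [h1 0, h1 9, h0, hG.vertices, hG.edges, hs, hc, hx]
    · rw [← hx]; exact hσ _ _
    · rw [Store.write_ne _ (by decide), hc]
    · rw [Store.write_same, Function.update_of_ne (by omega), h2]
    · rw [Store.write_same, Function.update_apply]
      split_ifs with c
      · rw [show k = j from Fin.ext (by omega)]
      · exact h3 k (by omega)

end Dag

/-! ### Assembly for shortest paths -/

theorem DagInstance.layout (I : DagInstance) :
    GraphLayout (wordArray I.encode) I.tail I.head ∧
      wordArray I.encode (I.m + I.n + I.n + 3) = (I.s : ℕ) ∧
      wordArray I.encode (I.m + I.n + I.n + 4) = (I.t : ℕ) ∧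
      DataLayout (wordArray I.encode) (I.m + I.n + I.n + (5 : ℕ)) I.data := by
  have h := block_wordArray I.encode
  nth_rw 2 [DagInstance.encode] at h
  rw [block_append, block_append, block_cons, block_cons] at h
  obtain ⟨⟨h1, h2, h3, -⟩, h4⟩ := h
  simp only [encGraph, List.length_append, List.length_cons, List.length_nil,
    List.length_ofFn] at h2 h3 h4
  refine ⟨graphLayout_of_block h1, ?_, ?_, dataLayout_of_block ?_⟩
  · rw [← h2]; congr 1; push_cast; ring
  · rw [← h3]; congr 1; push_cast; ring
  · convert h4 using 1; push_cast; ring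

theorem DagInstance.size_le (I : DagInstance) :
    I.m ≤ wordSize I.encode ∧ I.n ≤ wordSize I.encode ∧ I.data.N ≤ wordSize I.encode := by
  have h := length_le_wordSize I.encode
  simp only [DagInstance.encode, encGraph, WSData.encode, encRats, List.length_append,
    List.length_cons, List.length_ofFn] at h ⊢
  omega

theorem polyTimeSolvable_dag : PolyTimeSolvable DagInstance.encode DagInstance.Correct := by
  refine polyTimeSolvable_of_wp
    (.seq (.seq productProg (weightProg 5)) (.seq walksProg outputRowProg)) fun I => ?_
  obtain ⟨hG, hs, ht, hD⟩ := I.layout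
  obtain ⟨hm, hn, hN⟩ := I.size_le
  have hα := I.admissible.α_pos
  have hα' := I.admissible.α_lt_one
  set S := wordSize I.encode
  set W := I.data.weight (letterProduct I.encode)
  -- Labels stay below `2 ^ (5 * S)`, well within the memory bound.
  have hC : (I.m + 1) * (2 : ℤ) ^ (4 * S) < 2 ^ (10 * S + 10) := by
    have h1 : ((I.m : ℤ) + 1) ≤ 2 ^ S := by exact_mod_cast hm.trans_lt Nat.lt_two_pow_self
    calc _ ≤ (2 : ℤ) ^ S * 2 ^ (4 * S) := mul_le_mul_of_nonneg_right h1 (by positivity)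
      _ = 2 ^ (S + 4 * S) := (pow_add _ _ _).symm
      _ < _ := pow_lt_pow_right₀ (by norm_num) (by omega)
  refine WP.seq ((wp_prepare hG hD hα hα' hn hN).mono ?_)
  rintro σ1 - ⟨hF1, hW1⟩ hσ1
  refine WP.seq ((wp_walksProg hG I.acyclic hσ1 (hF1 0 (by simp)) ht (by omega) (by omega)
    (by omega) hW1 (hD.abs_weight_le hα hα' hN) hC (hF1 7 (by simp)) (hF1 8 (by simp))
    (hF1 9 (by simp))).mono ?_)
  rintro σ2 - ⟨hF2, hsound, hgood⟩ hσ2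
  have hle : ∀ p, IsDiwalk I.tail I.head I.s p I.t →
      0 < σ2 7 (I.s : ℕ) ∧ σ2 8 (I.s : ℕ) ≤ (p.map W).sum := fun p hp =>
    hgood I.s p hp (Or.inl (hp.length_le I.acyclic))
  -- A historic solution is a path from `s` to `t`, so `s` is certainly flagged at the end.
  obtain ⟨q, ⟨hq, -⟩, -⟩ := I.admissible.hist_mem ⟨0, I.admissible.N_pos⟩
  obtain ⟨p, hp, hd, hrow⟩ := hsound I.s (hle q hq).1
  refine (wp_outputRowProg (x := fun j => decide (j ∈ p)) hG hσ2
    ((hF2 0 (by simp)).trans (hF1 0 (by simp))) (by omega) hs fun j => ?_).mono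
    fun τ _ h => ⟨_, h, _, ?_, rfl⟩
  · rw [hrow]
    by_cases hj : j ∈ p <;> simp [hj]
  · obtain ⟨hc, hl⟩ := hD.den_dvd (by omega)
    refine I.data.isOptimal_of_totalWeight_le (letterProduct_pos _) hc hl
      ⟨p, ⟨hp, hp.nodup I.acyclic⟩, by simp⟩ ?_
    rintro y ⟨q, ⟨hq, -⟩, hy⟩
    rw [totalWeight_eq_sum_map (hp.nodup_edges I.acyclic) (p := p) (by simp),
      totalWeight_eq_sum_map (hq.nodup_edges I.acyclic) hy, ← hd]
    exact (hle q hq).2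

/-! ### Exchange in spanning trees -/

open SimpleGraph in
/-- If `u` and `v` are separated by a vertex set `S` and not adjacent in a tree, then some tree edge
leaving `S` can be exchanged for the edge between `u` and `v`. -/
theorem exists_isTree_exchange {V : Type*} {T : SimpleGraph V} (hT : T.IsTree) {S : Set V}
    {u v : V} (hu : u ∈ S) (hv : v ∉ S) (hadj : ¬ T.Adj u v) :
    ∃ x y, T.Adj x y ∧ x ∈ S ∧ y ∉ S ∧ (T.deleteEdges {s(x, y)} ⊔ edge u v).IsTree := by
  have huv : u ≠ v := fun h => hv (h ▸ hu)
  obtain ⟨p, hp, hpu⟩ := hT.existsUnique_path u v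
  -- The edge to remove is one at which the tree path from `u` to `v` leaves `S`.
  obtain ⟨d, hd, hdx, hdy⟩ := p.exists_boundary_dart S hu hv
  -- A path avoiding this edge would equal `p` by uniqueness, but `p` uses the edge.
  have hnr : ¬ (T.deleteEdges {s(d.fst, d.snd)}).Reachable u v := by
    intro hr
    obtain ⟨q, hq⟩ := hr.exists_isPath
    have hqp := hpu (q.mapLe (deleteEdges_le _)) (hq.mapLe _)
    have hmem : s(d.fst, d.snd) ∈ p.edges := List.mem_map.2 ⟨d, hd, rfl⟩
    rw [← hqp, Walk.edges_mapLe_eq_edges] at hmem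
    have := q.edges_subset_edgeSet hmem
    simp at this
  have hacyc : (T.deleteEdges {s(d.fst, d.snd)} ⊔ edge u v).IsAcyclic :=
    IsAcyclic.sup_edge_of_not_reachable hnr (hT.isAcyclic.anti (deleteEdges_le _))
  have hne : s(u, v) ≠ s(d.fst, d.snd) := fun h =>
    hadj ((mem_edgeSet T).1 (h ▸ (mem_edgeSet T).2 d.adj))
  have hdel : (T ⊔ edge u v).deleteEdges {s(d.fst, d.snd)} =
      T.deleteEdges {s(d.fst, d.snd)} ⊔ edge u v := by
    ext a b
    simp only [deleteEdges_adj, sup_adj, edge_adj, Set.mem_singleton_iff]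
    constructor
    · tauto
    · rintro (h | ⟨h, h'⟩)
      · tauto
      · refine ⟨Or.inr ⟨h, h'⟩, ?_⟩
        rcases h with ⟨rfl, rfl⟩ | ⟨rfl, rfl⟩
        · exact hne
        · rwa [Sym2.eq_swap]
  -- Otherwise the removed edge could be put back without creating a cycle, and `T` together with
  -- `uv` would be acyclic, against the maximality of the tree `T`.
  have hreach : (T.deleteEdges {s(d.fst, d.snd)} ⊔ edge u v).Reachable d.fst d.snd := by
    by_contra hr
    have h1 := IsAcyclic.sup_edge_of_not_reachable hr hacyc
    have h2 : T ⊔ edge u v ≤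
        T.deleteEdges {s(d.fst, d.snd)} ⊔ edge u v ⊔ edge d.fst d.snd := by
      intro a b h
      simp only [deleteEdges_adj, sup_adj, edge_adj, Set.mem_singleton_iff, Sym2.eq_iff] at h ⊢
      rcases h with h | h
      · have := h.ne
        tauto
      · tauto
    have h3 := ((isTree_iff_maximal_isAcyclic.1 hT).2.2 (h1.anti h2) le_sup_left)
    exact hadj (h3 (by simp [edge_adj, huv]))
  refine ⟨d.fst, d.snd, d.adj, hdx, hdy, ⟨?_, hacyc⟩⟩
  -- `T` together with `uv` is connected, and the removed edge is not a bridge of it.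
  rw [← hdel]
  refine (hT.connected.mono le_sup_left).connected_delete_edge_of_not_isBridge ?_
  rw [isBridge_iff, hdel]
  exact not_not.2 hreach

/-! ### Partial minimum spanning trees and the cut property -/

section Prim

variable {m n : ℕ} {tail head : Fin n → Fin m}

theorem selectedGraph_adj {x : Fin n → Bool} {a b : Fin m} :
    (selectedGraph tail head x).Adj a b ↔
      (∃ j, x j = true ∧ s(a, b) = s(tail j, head j)) ∧ a ≠ b := by
  simp [selectedGraph, SimpleGraph.fromEdgeSet_adj]

theorem selectedGraph_mono {x y : Fin n → Bool} (h : ∀ j, x j = true → y j = true) :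
    selectedGraph tail head x ≤ selectedGraph tail head y := by
  intro a b
  rw [selectedGraph_adj, selectedGraph_adj]
  rintro ⟨⟨j, hj, hab⟩, hne⟩
  exact ⟨⟨j, h j hj, hab⟩, hne⟩

theorem selectedGraph_update_true (x : Fin n → Bool) (j : Fin n) :
    selectedGraph tail head (Function.update x j true) =
      selectedGraph tail head x ⊔ SimpleGraph.edge (tail j) (head j) := by
  ext a b
  rw [SimpleGraph.sup_adj, selectedGraph_adj, selectedGraph_adj, SimpleGraph.edge_adj,
    ← Sym2.eq_iff]
  constructor
  · rintro ⟨⟨k, hk, hab⟩, hne⟩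
    by_cases hkj : k = j
    · subst hkj
      exact Or.inr ⟨hab, hne⟩
    · rw [Function.update_of_ne hkj] at hk
      exact Or.inl ⟨⟨k, hk, hab⟩, hne⟩
  · rintro (⟨⟨k, hk, hab⟩, hne⟩ | ⟨hab, hne⟩)
    · refine ⟨⟨k, ?_, hab⟩, hne⟩
      by_cases hkj : k = j <;> simp [hkj, hk]
    · exact ⟨⟨j, by simp, hab⟩, hne⟩

/-- Distinctness of the edges is essential: a parallel item would keep the two ends adjacent. -/
theorem selectedGraph_update_false (hinj : Function.Injective fun j => s(tail j, head j))
    (x : Fin n → Bool) (j : Fin n) :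
    selectedGraph tail head (Function.update x j false) =
      (selectedGraph tail head x).deleteEdges {s(tail j, head j)} := by
  ext a b
  rw [SimpleGraph.deleteEdges_adj, selectedGraph_adj, selectedGraph_adj, Set.mem_singleton_iff]
  constructor
  · rintro ⟨⟨k, hk, hab⟩, hne⟩
    have hkj : k ≠ j := by
      rintro rfl
      simp at hk
    rw [Function.update_of_ne hkj] at hk
    exact ⟨⟨⟨k, hk, hab⟩, hne⟩, fun h => hkj (hinj (hab.symm.trans h))⟩
  · rintro ⟨⟨⟨k, hk, hab⟩, hne⟩, h⟩
    have hkj : k ≠ j := fun e => h (e ▸ hab)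
    exact ⟨⟨k, by rwa [Function.update_of_ne hkj], hab⟩, hne⟩

theorem totalWeight_update (W : Fin n → ℤ) (x : Fin n → Bool) (j : Fin n) (b : Bool) :
    totalWeight W (Function.update x j b) =
      totalWeight W x + W j * ((b.toNat : ℤ) - ((x j).toNat : ℤ)) := by
  have h : ∀ y : Fin n → Bool, totalWeight W y =
      W j * ((y j).toNat : ℤ) + ∑ k ∈ Finset.univ.erase j, W k * ((y k).toNat : ℤ) := fun y =>
    (Finset.add_sum_erase _ _ (Finset.mem_univ j)).symm
  rw [h (Function.update x j b), h x, Function.update_self,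
    Finset.sum_congr rfl fun k hk => by rw [Function.update_of_ne (Finset.ne_of_mem_erase hk)]]
  ring

/-- The edge `j` leaves the vertex set `S`. -/
def Crosses (tail head : Fin n → Fin m) (S : Finset (Fin m)) (j : Fin n) : Prop :=
  ¬ (tail j ∈ S ↔ head j ∈ S)

/-- `x` spans the vertex set `S`, has no other edges, and is part of a minimum spanning tree. -/
structure IsPartialTree (tail head : Fin n → Fin m) (W : Fin n → ℤ) (S : Finset (Fin m))
    (x : Fin n → Bool) : Prop where
  nonempty : S.Nonempty
  reachable : ∀ u ∈ S, ∀ v ∈ S, (selectedGraph tail head x).Reachable u v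
  inside : ∀ j, x j = true → tail j ∈ S ∧ head j ∈ S
  extend : ∃ y ∈ spanningTreeVectors tail head,
    (∀ z ∈ spanningTreeVectors tail head, totalWeight W y ≤ totalWeight W z) ∧
      ∀ j, x j = true → y j = true

theorem IsPartialTree.singleton (W : Fin n → ℤ) (v : Fin m)
    (hne : (spanningTreeVectors tail head).Nonempty) :
    IsPartialTree tail head W {v} (fun _ => false) := by
  obtain ⟨y, hy, hmin⟩ := Set.exists_min_image _ (totalWeight W)
    (Set.toFinite (spanningTreeVectors tail head)) hne
  refine ⟨by simp, fun u hu w hw => ?_, by simp, y, hy, hmin, by simp⟩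
  rw [Finset.mem_singleton.1 hu, Finset.mem_singleton.1 hw]

/-- The minimum tree `y` extending `x` equals `x`: a further edge of `y` would be a bridge of `y`,
yet its ends are already joined by edges of `x`. -/
theorem IsPartialTree.mem_of_eq_univ {W : Fin n → ℤ} {x : Fin n → Bool}
    (h : IsPartialTree tail head W Finset.univ x) (hloop : ∀ j, tail j ≠ head j)
    (hinj : Function.Injective fun j => s(tail j, head j)) :
    x ∈ spanningTreeVectors tail head ∧
      ∀ z ∈ spanningTreeVectors tail head, totalWeight W x ≤ totalWeight W z := by
  obtain ⟨y, hy, hmin, hxy⟩ := h.extend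
  have hyx : ∀ j, y j = true → x j = true := by
    intro j hj
    by_contra hxj
    have hadj : (selectedGraph tail head y).Adj (tail j) (head j) :=
      selectedGraph_adj.2 ⟨⟨j, hj, rfl⟩, hloop j⟩
    have hbridge := SimpleGraph.isAcyclic_iff_forall_adj_isBridge.1 hy.isAcyclic hadj
    rw [SimpleGraph.isBridge_iff, ← selectedGraph_update_false hinj] at hbridge
    refine hbridge ((h.reachable _ (Finset.mem_univ _) _ (Finset.mem_univ _)).mono
      (selectedGraph_mono fun k hk => ?_))
    have hkj : k ≠ j := fun e => hxj (e ▸ hk)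
    rw [Function.update_of_ne hkj]
    exact hxy k hk
  obtain rfl : x = y := funext fun j => Bool.eq_iff_iff.2 ⟨hxy j, hyx j⟩
  exact ⟨hy, hmin⟩

/-- A spanning tree joins a vertex of `S` to any vertex outside, and this path has an edge leaving
`S`. -/
theorem IsPartialTree.eq_univ {W : Fin n → ℤ} {S : Finset (Fin m)} {x : Fin n → Bool}
    (h : IsPartialTree tail head W S x) (hcross : ∀ j, ¬ Crosses tail head S j) :
    S = Finset.univ := by
  obtain ⟨y, hy, -⟩ := h.extend
  obtain ⟨u, hu⟩ := h.nonempty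
  by_contra hS
  obtain ⟨v, hv⟩ : ∃ v, v ∉ S := by
    by_contra hall
    push Not at hall
    exact hS (Finset.eq_univ_of_forall hall)
  obtain ⟨p⟩ := hy.connected.preconnected u v
  obtain ⟨d, -, h1, h2⟩ := p.exists_boundary_dart (S : Set (Fin m)) hu hv
  obtain ⟨⟨j, -, hj⟩, -⟩ := selectedGraph_adj.1 d.adj
  apply hcross j
  simp only [Finset.mem_coe] at h1 h2
  rcases Sym2.eq_iff.1 hj with ⟨e1, e2⟩ | ⟨e1, e2⟩
  · rw [Crosses, ← e1, ← e2]; tauto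
  · rw [Crosses, ← e1, ← e2]; tauto

/-- The cut property. If the optimal tree `y` extending `x` misses `j`, exchanging some crossing
edge `f` of `y` for `j` does not increase the weight. Both ends of `j` are inserted because the
program marks both without testing which one is new. -/
theorem IsPartialTree.insert_edge {W : Fin n → ℤ} {S : Finset (Fin m)} {x : Fin n → Bool}
    (h : IsPartialTree tail head W S x)
    (hinj : Function.Injective fun j => s(tail j, head j)) {j : Fin n}
    (hj : Crosses tail head S j) (hmin : ∀ k, Crosses tail head S k → W j ≤ W k) :
    IsPartialTree tail head W (insert (tail j) (insert (head j) S))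
      (Function.update x j true) := by
  obtain ⟨u, v, hu, hv, huv⟩ : ∃ u v, u ∈ S ∧ v ∉ S ∧ s(u, v) = s(tail j, head j) := by
    by_cases ht : tail j ∈ S
    · exact ⟨tail j, head j, ht, fun hh => hj (by simp [ht, hh]), rfl⟩
    · exact ⟨head j, tail j, by_contra fun hh => hj (by simp [ht, hh]), ht, Sym2.eq_swap⟩
  have hS : insert (tail j) (insert (head j) S) = insert v S := by
    rcases Sym2.eq_iff.1 huv with ⟨rfl, rfl⟩ | ⟨rfl, rfl⟩
    · rw [Finset.insert_comm, Finset.insert_eq_of_mem hu]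
    · rw [Finset.insert_eq_of_mem hu]
  have hedge : SimpleGraph.edge (tail j) (head j) = SimpleGraph.edge u v := by
    rcases Sym2.eq_iff.1 huv with ⟨rfl, rfl⟩ | ⟨rfl, rfl⟩
    · rfl
    · exact SimpleGraph.edge_comm _ _
  have hne : u ≠ v := fun e => hv (e ▸ hu)
  have hroot : ∀ w ∈ insert v S,
      (selectedGraph tail head (Function.update x j true)).Reachable u w := by
    intro w hw
    rw [selectedGraph_update_true, hedge]
    rcases Finset.mem_insert.1 hw with rfl | hw
    · exact SimpleGraph.Adj.reachable (by simp [SimpleGraph.edge_adj, hne])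
    · exact (h.reachable u hu w hw).mono le_sup_left
  refine ⟨⟨tail j, by simp⟩, ?_, fun k hk => ?_, ?_⟩
  · rw [hS]
    exact fun a ha b hb => (hroot a ha).symm.trans (hroot b hb)
  · by_cases hkj : k = j
    · simp [hkj]
    · rw [Function.update_of_ne hkj] at hk
      simp [h.inside k hk]
  obtain ⟨y, hy, hopt, hxy⟩ := h.extend
  have hupd : ∀ y' : Fin n → Bool, y' j = true → (∀ k, x k = true → y' k = true) →
      ∀ k, Function.update x j true k = true → y' k = true := by
    intro y' h1 h2 k hk
    by_cases hkj : k = j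
    · rw [hkj, h1]
    · rw [Function.update_of_ne hkj] at hk
      exact h2 k hk
  by_cases hyj : y j = true
  · exact ⟨y, hy, hopt, hupd y hyj hxy⟩
  have hnadj : ¬ (selectedGraph tail head y).Adj u v := by
    rw [selectedGraph_adj]
    rintro ⟨⟨k, hk, e⟩, -⟩
    exact hyj (hinj (huv.symm.trans e) ▸ hk)
  -- The removed edge `f` crosses the same cut as `j`, so `W j ≤ W f` by the choice of `j`.
  obtain ⟨a, b, hab, ha, hb, htree⟩ := exists_isTree_exchange hy (S := (S : Set (Fin m))) hu hv hnadj
  obtain ⟨⟨f, hf, hfab⟩, -⟩ := selectedGraph_adj.1 hab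
  simp only [Finset.mem_coe] at ha hb
  have hfc : Crosses tail head S f := by
    rcases Sym2.eq_iff.1 hfab with ⟨e1, e2⟩ | ⟨e1, e2⟩
    · rw [Crosses, ← e1, ← e2]; tauto
    · rw [Crosses, ← e1, ← e2]; tauto
  have hjf : j ≠ f := fun e => hyj (e ▸ hf)
  refine ⟨Function.update (Function.update y f false) j true, ?_, fun z hz => ?_,
    hupd _ (by simp) fun k hk => ?_⟩
  · change (selectedGraph tail head _).IsTree
    rw [selectedGraph_update_true, selectedGraph_update_false hinj, hedge, ← hfab]
    exact htree
  · refine le_trans ?_ (hopt z hz)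
    rw [totalWeight_update, totalWeight_update, Function.update_of_ne hjf, hf,
      Bool.eq_false_of_not_eq_true hyj]
    have := hmin f hfc
    simp
    omega
  · by_cases hkj : k = j
    · simp [hkj]
    · have hkf : k ≠ f := by
        rintro rfl
        -- Edges of `x` lie inside `S`, so the removed crossing edge is none of them.
        exact hfc (by simp [h.inside k hk])
      rw [Function.update_of_ne hkj, Function.update_of_ne hkf]
      exact hxy k hk

/-- Strict growth is the progress measure that makes `m` rounds sufficient. -/
theorem card_lt_card_insert_edge {S : Finset (Fin m)} {j : Fin n} (hj : Crosses tail head S j) :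
    S.card < (insert (tail j) (insert (head j) S)).card := by
  refine Finset.card_lt_card (Finset.ssubset_iff_subset_ne.2 ⟨fun v hv => by simp [hv], fun e => ?_⟩)
  refine hj ?_
  rw [e]
  simp

end Prim

/-! ### A program for minimum spanning trees -/

section Mst

open ExplOpt.Expr

/-- Remember the edge with index in cell `0` of array `5`, one added, if it leaves the vertex set
given by array `7` and is lighter than the edge remembered before. -/
def selectProg : Prog :=
  let j : Expr := var 5
  let diff : Expr := .cell 7 (tailOf j) - .cell 7 (headOf j)
  -- The squared difference of two indicator values is `1` for edges leaving the set and `0` for all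
  -- others.
  .branch (diff * diff)
    (.branch (var 10)
      (.branch (.cell 2 (var 10 - 1) - .cell 2 j) (.assign 10 0 (j + 1)) .nop)
      (.assign 10 0 (j + 1)))
    .nop

/-- Add the remembered edge to the tree. -/
def extendProg : Prog :=
  .branch (var 10)
    (.seq (.assign 7 (headOf (var 10 - 1)) 1)
      -- The remembered number is the edge index plus one, which is exactly the output cell of this
      -- edge.
      (.seq (.assign 7 (tailOf (var 10 - 1)) 1) (.assign 1 (var 10) 1)))
    .nop

/-- A minimum spanning tree. -/
def primProg : Prog :=
  .seq (.assign 7 0 1)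
    (.seq (.for 4 (inp 1)
        (.seq (.seq (.assign 10 0 0) (.for 5 (inp 2) selectProg)) extendProg))
      (.assign 1 0 (inp 2)))

variable {m n : ℕ} {tail head : Fin n → Fin m} {A : ℤ → ℤ}

/-- The array `a` contains the indicator function of `S`. -/
def IsIndicator (S : Finset (Fin m)) (a : ℤ → ℤ) : Prop :=
  ∀ v : Fin m, a (v : ℕ) = if v ∈ S then 1 else 0

theorem IsIndicator.insert {S : Finset (Fin m)} {a : ℤ → ℤ} (h : IsIndicator S a) (v : Fin m) :
    IsIndicator (insert v S) (Function.update a (v : ℕ) 1) := by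
  intro u
  rw [Function.update_apply]
  by_cases huv : u = v
  · simp [huv]
  · rw [if_neg fun e => huv (Fin.ext (by exact_mod_cast e)), h u]
    simp [huv]

/-- `z` is `0` if none of the first `i` edges leaves `S`, and otherwise one more than the index of
a lightest such edge. -/
def IsLightest (tail head : Fin n → Fin m) (W : Fin n → ℤ) (S : Finset (Fin m)) (i : ℕ)
    (z : ℤ) : Prop :=
  (z = 0 ∧ ∀ k : Fin n, (k : ℕ) < i → ¬ Crosses tail head S k) ∨
    ∃ b : Fin n, z = (b : ℕ) + 1 ∧ Crosses tail head S b ∧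
      ∀ k : Fin n, (k : ℕ) < i → Crosses tail head S k → W b ≤ W k

theorem wp_selectProg {M : ℕ} {σ : Store} {W : Fin n → ℤ} {S : Finset (Fin m)} {j : Fin n}
    (hG : GraphLayout A tail head) (hσ : Bounded M σ) (h0 : σ 0 = A) (hn : n ≤ M)
    (hj : σ 5 0 = (j : ℕ)) (hW : ∀ j : Fin n, σ 2 (j : ℕ) = W j) (hS : IsIndicator S (σ 7))
    (hbest : IsLightest tail head W S j (σ 10 0)) :
    WP M selectProg (fun τ => Frame [10] σ τ ∧ IsLightest tail head W S (j + 1) (τ 10 0)) σ := by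
  classical
  have ht : (tailOf (var 5)).val σ = (tail j : ℕ) := hG.val_tailOf h0 (by simp [hj])
  have hh : (headOf (var 5)).val σ = (head j : ℕ) := hG.val_headOf h0 (by simp [hj])
  have hassign : Crosses tail head S j →
      (∀ k : Fin n, (k : ℕ) < j → Crosses tail head S k → W j ≤ W k) →
      WP M (.assign 10 0 (var 5 + 1))
        (fun τ => Frame [10] σ τ ∧ IsLightest tail head W S (j + 1) (τ 10 0)) σ := by
    intro hc hmin
    refine WP.assign_of_eq (x := 0) (z := ((j + 1 : ℕ) : ℤ)) hσ (by simp) (by simp [hj])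
      (bits_natCast_le (by omega)) ⟨(Frame.refl _ _).write (by simp) _ _, Or.inr ⟨j, ?_, hc, ?_⟩⟩
    · simp [Store.write_same]
    · intro k hk hck
      rcases Nat.lt_succ_iff_lt_or_eq.1 hk with hk | hk
      · exact hmin k hk hck
      · rw [Fin.ext hk]
  refine WP.branch_of_eq (z := if Crosses tail head S j then 1 else 0) hσ ?_ (fun hc => ?_)
    fun hc => ?_
  · simp only [val_mul', val_sub', val_cell, ht, hh, hS _, Crosses]
    by_cases h1 : tail j ∈ S <;> by_cases h2 : head j ∈ S <;> simp [h1, h2]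
  · have hc : Crosses tail head S j := by
      by_contra h
      simp [h] at hc
    refine WP.branch_of_eq (z := σ 10 0) hσ (by simp) (fun hpos => ?_) fun hneg => ?_
    · obtain ⟨hz, -⟩ | ⟨b, hz, hb, hmin⟩ := hbest
      · omega
      refine WP.branch_of_eq (z := W b - W j) hσ (by simp [hz, hj, hW]) (fun hlt => ?_) fun hle => ?_
      · exact hassign hc fun k hk hck => by have := hmin k hk hck; omega
      · refine WP.nop hσ ⟨Frame.refl _ _, Or.inr ⟨b, hz, hb, fun k hk hck => ?_⟩⟩
        rcases Nat.lt_succ_iff_lt_or_eq.1 hk with hk | hk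
        · exact hmin k hk hck
        · rw [Fin.ext hk]; omega
    · obtain ⟨-, hno⟩ | ⟨b, hz, -⟩ := hbest
      · exact hassign hc fun k hk hck => absurd hck (hno k hk)
      · omega
  · have hc : ¬ Crosses tail head S j := fun h => by simp [h] at hc
    refine WP.nop hσ ⟨Frame.refl _ _, ?_⟩
    obtain ⟨hz, hno⟩ | ⟨b, hz, hb, hmin⟩ := hbest
    · refine Or.inl ⟨hz, fun k hk => ?_⟩
      rcases Nat.lt_succ_iff_lt_or_eq.1 hk with hk | hk
      · exact hno k hk
      · rwa [Fin.ext hk]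
    · refine Or.inr ⟨b, hz, hb, fun k hk hck => ?_⟩
      rcases Nat.lt_succ_iff_lt_or_eq.1 hk with hk | hk
      · exact hmin k hk hck
      · exact absurd (Fin.ext hk ▸ hck) hc

theorem wp_select_all {M : ℕ} {σ : Store} {W : Fin n → ℤ} {S : Finset (Fin m)}
    (hG : GraphLayout A tail head) (hσ : Bounded M σ) (h0 : σ 0 = A) (hn : n ≤ M)
    (hW : ∀ j : Fin n, σ 2 (j : ℕ) = W j) (hS : IsIndicator S (σ 7)) :
    WP M (.seq (.assign 10 0 0) (.for 5 (inp 2) selectProg))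
      (fun τ => Frame [5, 10] σ τ ∧ IsLightest tail head W S n (τ 10 0)) σ := by
  refine WP.seq (WP.assign_of_eq (x := 0) (z := 0) hσ (by simp) (by simp) (by simp [bits])
    fun hσ1 => ?_)
  refine WP.for (fun i τ => Frame [5, 10] σ τ ∧ IsLightest tail head W S i (τ 10 0)) (K := n) hn
    hσ1 ⟨(Frame.refl _ _).write (by simp) _ _, Or.inl ⟨by simp [Store.write_same], by simp⟩⟩
    ?_ ?_ ?_
  · rintro i τ z ⟨h1, h2⟩
    exact ⟨h1.write (by simp) _ _, by rwa [Store.write_ne _ (by decide)]⟩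
  · rintro i τ ⟨h1, -⟩
    simp [h1 0 (by simp), h0, hG.edges]
  · rintro i hi τ hτ hc ⟨h1, h2⟩
    obtain ⟨j, rfl⟩ : ∃ j : Fin n, (j : ℕ) = i := ⟨⟨i, hi⟩, rfl⟩
    refine (wp_selectProg hG hτ ((h1 0 (by simp)).trans h0) hn hc
      (fun j => by rw [h1 2 (by simp), hW]) (by rwa [h1 7 (by simp)]) h2).mono fun υ _ h => ?_
    exact ⟨by rw [h.1 5 (by simp), hc], h1.trans_of_subset h.1 (by simp) (by simp), h.2⟩

/-- If no edge is remembered, none leaves `S`, so `S` is the whole vertex set. Rounds after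
completion therefore change nothing. -/
theorem wp_extendProg {M : ℕ} {σ : Store} {W : Fin n → ℤ} {S : Finset (Fin m)} {x : Fin n → Bool}
    (hG : GraphLayout A tail head) (hinj : Function.Injective fun j => s(tail j, head j))
    (hσ : Bounded M σ) (h0 : σ 0 = A) (hM : 1 ≤ M) (hS : IsIndicator S (σ 7))
    (hx : ∀ j : Fin n, σ 1 ((j : ℕ) + 1) = (x j).toNat)
    (hbest : IsLightest tail head W S n (σ 10 0)) (hSx : IsPartialTree tail head W S x) :
    WP M extendProg (fun τ => Frame [1, 7] σ τ ∧ ∃ (S' : Finset (Fin m)) (x' : Fin n → Bool),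
      IsIndicator S' (τ 7) ∧ (∀ j : Fin n, τ 1 ((j : ℕ) + 1) = (x' j).toNat) ∧
      IsPartialTree tail head W S' x' ∧ (S' = Finset.univ ∨ S.card < S'.card)) σ := by
  have hone : bits 1 ≤ M := by simpa [bits] using hM
  refine WP.branch_of_eq (z := σ 10 0) hσ (by simp) (fun hpos => ?_) fun hneg => ?_
  · obtain ⟨hz, -⟩ | ⟨b, hz, hb, hmin⟩ := hbest
    · omega
    have hF := Frame.refl [1, 7] σ
    have hidx : ∀ τ : Store, Frame [1, 7] σ τ → (var 10 - 1 : Expr).val τ = (b : ℕ) := fun τ h => by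
      simp [h 10, hz]
    refine WP.seq (WP.assign_of_eq (z := 1) hσ (hG.val_headOf h0 (hidx _ hF)) (by simp) hone
      fun hσ1 => ?_)
    have hF1 := hF.write (k := 7) (by simp) (head b : ℕ) 1
    refine WP.seq (WP.assign_of_eq (z := 1) hσ1
      (hG.val_tailOf ((hF1 0 (by simp)).trans h0) (hidx _ hF1)) (by simp) hone fun hσ2 => ?_)
    have hF2 := hF1.write (k := 7) (by simp) (tail b : ℕ) 1
    refine WP.assign_of_eq (x := (b : ℕ) + 1) (z := 1) hσ2 ?_ (by simp) hone
      ⟨hF2.write (by simp) _ _, _, Function.update x b true, ?_, fun k => ?_,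
        hSx.insert_edge hinj hb fun k => hmin k k.2, Or.inr (card_lt_card_insert_edge hb)⟩
    · simp [hF2 10, hz]
    · rw [Store.write_ne _ (by decide), Store.write_same, Store.write_same]
      exact (hS.insert _).insert _
    · rw [Store.write_same, Store.write_ne _ (by decide), Store.write_ne _ (by decide)]
      by_cases hkb : k = b
      · simp [hkb]
      · have : (k : ℕ) ≠ b := fun e => hkb (Fin.ext e)
        rw [Function.update_of_ne (by omega), Function.update_of_ne hkb, hx]
  · obtain ⟨-, hno⟩ | ⟨b, hz, -⟩ := hbest
    · exact WP.nop hσ ⟨Frame.refl _ _, S, x, hS, hx, hSx,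
        Or.inl (hSx.eq_univ fun j => hno j j.2)⟩
    · omega

theorem wp_primProg {M : ℕ} {σ : Store} {W : Fin n → ℤ}
    (hG : GraphLayout A tail head) (hloop : ∀ j, tail j ≠ head j)
    (hinj : Function.Injective fun j => s(tail j, head j)) (hσ : Bounded M σ) (h0 : σ 0 = A)
    (hM : 1 ≤ M) (hn : n ≤ M) (hm : m ≤ M) (hW : ∀ j : Fin n, σ 2 (j : ℕ) = W j)
    (h1 : σ 1 = fun _ => 0) (h7 : σ 7 = fun _ => 0)
    (hne : (spanningTreeVectors tail head).Nonempty) :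
    WP M primProg (fun τ => ∃ x ∈ spanningTreeVectors tail head, Outputs τ (encVec x) ∧
      ∀ z ∈ spanningTreeVectors tail head, totalWeight W x ≤ totalWeight W z) σ := by
  have hone : bits 1 ≤ M := by simpa [bits] using hM
  obtain ⟨y, hy⟩ := hne
  -- A tree has a vertex, so vertex `0` exists and can serve as the root.
  obtain ⟨v⟩ := hy.connected.nonempty
  have hmpos : 0 < m := v.pos
  have h7' : IsIndicator {(⟨0, hmpos⟩ : Fin m)} (Function.update (σ 7) 0 1) := by
    have h : IsIndicator (∅ : Finset (Fin m)) (σ 7) := fun u => by simp [h7]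
    exact h.insert ⟨0, hmpos⟩
  refine WP.seq (WP.assign_of_eq (x := 0) (z := 1) hσ (by simp) (by simp) hone fun hσ1 => ?_)
  refine WP.seq ((WP.for (fun i τ => Frame [1, 4, 5, 7, 10] σ τ ∧
    ∃ (S : Finset (Fin m)) (x : Fin n → Bool), IsIndicator S (τ 7) ∧
      (∀ j : Fin n, τ 1 ((j : ℕ) + 1) = (x j).toNat) ∧ IsPartialTree tail head W S x ∧
      (S = Finset.univ ∨ i < S.card)) (K := m) hm hσ1
    ⟨(Frame.refl _ _).write (by simp) _ _, {⟨0, hmpos⟩}, fun _ => false, ?_, ?_,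
      IsPartialTree.singleton W _ ⟨y, hy⟩, by simp⟩ ?_ ?_ ?_).mono ?_)
  · rwa [Store.write_same]
  · simp [Store.write_ne, h1]
  · rintro i τ z ⟨k1, k2⟩
    refine ⟨k1.write (by simp) _ _, ?_⟩
    rwa [Store.write_ne _ (by decide), Store.write_ne _ (by decide)]
  · rintro i τ ⟨k1, -⟩
    simp [k1 0 (by simp), h0, hG.vertices]
  · rintro i - τ hτ hc ⟨k1, S, x, hS, hx, hSx, hcard⟩
    refine WP.seq ((wp_select_all (W := W) hG hτ ((k1 0 (by simp)).trans h0) hn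
      (fun j => by rw [k1 2 (by simp), hW]) hS).mono fun υ _ ⟨l1, l2⟩ hυ => ?_)
    have hF : Frame [1, 4, 5, 7, 10] σ υ := k1.trans_of_subset l1 (by simp) (by simp)
    refine (wp_extendProg hG hinj hυ ((hF 0 (by simp)).trans h0) hM
      (by rwa [l1 7 (by simp)]) (by rwa [l1 1 (by simp)]) l2 hSx).mono ?_
    rintro ω - ⟨g1, S', x', hS', hx', hSx', hcard'⟩
    refine ⟨by rw [g1 4 (by simp), l1 4 (by simp), hc],
      hF.trans_of_subset g1 (by simp) (by simp), S', x', hS', hx', hSx', ?_⟩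
    rcases hcard' with h | h
    · exact Or.inl h
    rcases hcard with rfl | hcard
    -- Once `S` contains all vertices, a strictly larger set is impossible.
    · have := Finset.card_le_univ S'
      rw [Finset.card_univ] at h
      omega
    · exact Or.inr (by omega)
  · rintro τ - ⟨k1, S, x, hS, hx, hSx, hcard⟩ hτ
    have hSu : S = Finset.univ := by
      refine hcard.resolve_right fun h => ?_
      have := Finset.card_le_univ S
      rw [Fintype.card_fin] at this
      omega
    subst hSu
    obtain ⟨hmem, hmin⟩ := hSx.mem_of_eq_univ hloop hinj
    refine WP.assign_of_eq (x := 0) (z := n) hτ (by simp)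
      (by simp [k1 0 (by simp), h0, hG.edges]) (bits_natCast_le hn)
      ⟨x, hmem, outputs_encVec (by simp [Store.write_same]) fun j => ?_, hmin⟩
    rw [Store.write_same, Function.update_of_ne (by omega), hx]

end Mst

/-! ### Assembly for spanning trees -/

theorem MstInstance.layout (I : MstInstance) :
    GraphLayout (wordArray I.encode) I.tail I.head ∧
      DataLayout (wordArray I.encode) (I.m + I.n + I.n + (3 : ℕ)) I.data := by
  have h := block_wordArray I.encode
  nth_rw 2 [MstInstance.encode] at h
  rw [block_append] at h
  refine ⟨graphLayout_of_block h.1, dataLayout_of_block ?_⟩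
  convert h.2 using 1
  simp only [encGraph, List.length_append, List.length_cons, List.length_nil, List.length_ofFn]
  push_cast
  ring

theorem MstInstance.size_le (I : MstInstance) :
    I.m ≤ wordSize I.encode ∧ I.n ≤ wordSize I.encode ∧ I.data.N ≤ wordSize I.encode := by
  have h := length_le_wordSize I.encode
  simp only [MstInstance.encode, encGraph, WSData.encode, encRats, List.length_append,
    List.length_cons, List.length_ofFn] at h ⊢
  omega

theorem polyTimeSolvable_mst : PolyTimeSolvable MstInstance.encode MstInstance.Correct := by
  refine polyTimeSolvable_of_wp (.seq (.seq productProg (weightProg 3)) primProg) fun I => ?_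
  obtain ⟨hG, hD⟩ := I.layout
  obtain ⟨hm, hn, hN⟩ := I.size_le
  refine WP.seq ((wp_prepare hG hD I.admissible.α_pos I.admissible.α_lt_one hn hN).mono ?_)
  rintro σ - ⟨hF, hW⟩ hσ
  refine (wp_primProg hG I.loopless I.edges_distinct hσ (hF 0 (by simp)) (by omega) (by omega)
    (by omega) hW (hF 1 (by simp)) (hF 7 (by simp))
    -- A historic solution witnesses that a spanning tree exists.
    ⟨_, I.admissible.hist_mem ⟨0, I.admissible.N_pos⟩⟩).mono ?_
  rintro τ - ⟨x, hx, hout, hmin⟩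
  obtain ⟨hc, hl⟩ := hD.den_dvd (by omega)
  exact ⟨_, hout, x,
    I.data.isOptimal_of_totalWeight_le (letterProduct_pos _) hc hl hx hmin, rfl⟩

end ExplOpt

theorem mainTheorem3 :
    ExplOpt.PolyTimeSolvable ExplOpt.DagInstance.encode ExplOpt.DagInstance.Correct ∧
      ExplOpt.PolyTimeSolvable ExplOpt.MstInstance.encode ExplOpt.MstInstance.Correct :=
  ⟨ExplOpt.polyTimeSolvable_dag, ExplOpt.polyTimeSolvable_mst⟩
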